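/- Let $G$ be a set of ordered pairs in $[n]^2$ (a graph on $[n]$; both orientations of a pair, and loops, are allowed). A 2XOR instance on $G$ is a choice of signs $b_{uv}\in\{\pm1\}$, $(u,v)\in G$, with constraints $x_ux_v=b_{uv}$; an assignment $x\in\{\pm1\}^n$ is $(1-\eta)$-satisfying if it satisfies at least $(1-\eta)|G|$ of the $|G|$ constraints. For $m\le n^2$, let $\mathcal H_2(m,n)$ be the random graph in which each of the $n^2$ ordered pairs is included independently with probability $m/n^2$. Put $$B_n(\eta)=\begin{cases}2,&\eta\le \frac1{3n},\\ 2e^{3\eta n\log n},&\eta>\frac1{3n}.\end{cases}$$ **Theorem.** There is an absolute constant $c>0$ such that for every constant $\delta\in(0,1]$ there are a deterministic polynomial-time algorithm, which accepts or rejects graphs, and a number $n_0=n_0(\delta)$ with the following properties. Define the certified value for $\eta\in[0,1]$ on a graph $G$ with $n$ vertices to be $B_n(\eta)$ if $G$ is accepted and $2^n$ if $G$ is rejected. 1. (Certification.) For every $n$, every graph $G$ on $[n]$, every $\eta\in[0,1]$ and every 2XOR instance on $G$, the number of $(1-\eta)$-satisfying assignments is at most the certified value. 2. (Closeness.) If $G$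 is accepted, then for every $\eta\in[0,1]$, every 2XOR instance on $G$ and any two of its $(1-\eta)$-satisfying assignments $x,x'$, the Hamming distance of $x'$ from $x$ or from $-x$ is at most $3\eta n$. 3. (Success probability.) For all $n\ge n_0$, a random graph from $\mathcal H_2(m,n)$ with $m=n^{1+\delta}$ is accepted, so that its certified value is $B_n(\eta)$ for all $\eta\in[0,1]$ simultaneously, with probability at least $1-\exp(-n^{c\delta})$. -/

import Mathlib

open MeasureTheory

namespace TwoXor

/-! ### Graphs, 2XOR instances and the random graph -/

/-- A `2`-uniform hypergraph on the vertex set `Fin n`: a set of ordered pairs (loops allowed),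
given by its indicator function. -/
abbrev PairGraph (n : ℕ) : Type := Fin n × Fin n → Bool

/-- The edge set of a graph. -/
def edges {n : ℕ} (G : PairGraph n) : Finset (Fin n × Fin n) :=
  Finset.univ.filter fun e => G e = true

/-- An assignment in `{1, -1}ⁿ`. -/
abbrev Assignment (n : ℕ) : Type := Fin n → ℤˣ

/-- The signs of a 2XOR instance: the instance on `G` with signs `b` has, for every edge `(u, v)`
of `G`, the constraint `x u * x v = b (u, v)`.  Values of `b` off the edges of `G` play no role. -/
abbrev Signing (n : ℕ) : Type := Fin n × Fin n → ℤˣ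

/-- The constraints of the instance `(G, b)` that `x` satisfies. -/
def satisfied {n : ℕ} (G : PairGraph n) (b : Signing n) (x : Assignment n) :
    Finset (Fin n × Fin n) :=
  (edges G).filter fun e => x e.1 * x e.2 = b e

/-- `x` is `(1 - η)`-satisfying for the instance `(G, b)`: it satisfies at least a `1 - η` fraction
of the constraints. -/
def IsApproxSat {n : ℕ} (G : PairGraph n) (b : Signing n) (η : ℝ) (x : Assignment n) : Prop :=
  (1 - η) * ((edges G).card : ℝ) ≤ ((satisfied G b x).card : ℝ)

/-- The random graph: each of the `n²` ordered pairs is an edge independently with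
probability `m / n²` (a number which is clamped to `[0, 1]` if it lies outside). -/
noncomputable def randomGraph (n : ℕ) (m : ℝ) : Measure (PairGraph n) :=
  Measure.pi fun _ => ProbabilityTheory.bernoulliMeasure true false
    (Set.projIcc (0 : ℝ) 1 zero_le_one (m / (n : ℝ) ^ 2))

/-! ### Polynomial time

Random access machines with unit-cost steps: finitely many registers and an unbounded memory with
indirect addressing, all holding natural numbers.  The arithmetic operations are addition and
truncated subtraction, so that `t` steps increase bit lengths by at most `t`, and time on this
machine agrees with Turing machine time up to a polynomial. -/

/-- Programs of the machine.  A program mentions finitely many registers, named by numerals. -/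
inductive Prog : Type
  | const (d c : ℕ)
  | add (d a b : ℕ)
  | sub (d a b : ℕ)
  | load (d a : ℕ)
  | store (a s : ℕ)
  | seq (p q : Prog)
  | ifPos (r : ℕ) (p q : Prog)
  | whilePos (r : ℕ) (p : Prog)

/-- The contents of the registers and of the memory. -/
structure State : Type where
  reg : ℕ → ℕ
  mem : ℕ → ℕ

/-- The state after register `d` has been set to `v`. -/
def State.setReg (s : State) (d v : ℕ) : State := ⟨Function.update s.reg d v, s.mem⟩

/-- The state after the memory cell with address `a` has been set to `v`. -/
def State.setMem (s : State) (a v : ℕ) : State := ⟨s.reg, Function.update s.mem a v⟩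

/-- `Runs p s s' t`: started in state `s`, program `p` halts in state `s'` after exactly `t` steps.
Each basic instruction and each test of a register takes one step. -/
inductive Runs : Prog → State → State → ℕ → Prop
  | const (s : State) (d c : ℕ) : Runs (.const d c) s (s.setReg d c) 1
  | add (s : State) (d a b : ℕ) : Runs (.add d a b) s (s.setReg d (s.reg a + s.reg b)) 1
  | sub (s : State) (d a b : ℕ) : Runs (.sub d a b) s (s.setReg d (s.reg a - s.reg b)) 1
  | load (s : State) (d a : ℕ) : Runs (.load d a) s (s.setReg d (s.mem (s.reg a))) 1
  | store (s : State) (a r : ℕ) : Runs (.store a r) s (s.setMem (s.reg a) (s.reg r)) 1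
  | seq {p q : Prog} {s₁ s₂ s₃ : State} {t₁ t₂ : ℕ} :
      Runs p s₁ s₂ t₁ → Runs q s₂ s₃ t₂ → Runs (.seq p q) s₁ s₃ (t₁ + t₂)
  | ifTrue {r : ℕ} {p q : Prog} {s s' : State} {t : ℕ} :
      0 < s.reg r → Runs p s s' t → Runs (.ifPos r p q) s s' (t + 1)
  | ifFalse {r : ℕ} {p q : Prog} {s s' : State} {t : ℕ} :
      s.reg r = 0 → Runs q s s' t → Runs (.ifPos r p q) s s' (t + 1)
  | whileTrue {r : ℕ} {p : Prog} {s₁ s₂ s₃ : State} {t₁ t₂ : ℕ} :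
      0 < s₁.reg r → Runs p s₁ s₂ t₁ → Runs (.whilePos r p) s₂ s₃ t₂ →
      Runs (.whilePos r p) s₁ s₃ (t₁ + t₂ + 1)
  | whileFalse {r : ℕ} {p : Prog} {s : State} :
      s.reg r = 0 → Runs (.whilePos r p) s s 1

/-- The machine is deterministic. -/
theorem Runs.deterministic {p : Prog} {s s₁ : State} {t₁ : ℕ} (h₁ : Runs p s s₁ t₁) :
    ∀ {s₂ : State} {t₂ : ℕ}, Runs p s s₂ t₂ → s₁ = s₂ ∧ t₁ = t₂ := by
  induction h₁ with
  | const | add | sub | load | store => intro s₂ t₂ h; cases h; exact ⟨rfl, rfl⟩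
  | seq _ _ ih₁ ih₂ =>
    intro s₂ t₂ h
    cases h with
    | seq a b =>
      obtain ⟨rfl, rfl⟩ := ih₁ a
      obtain ⟨rfl, rfl⟩ := ih₂ b
      exact ⟨rfl, rfl⟩
  | ifTrue hr _ ih =>
    intro s₂ t₂ h
    cases h with
    | ifTrue _ a => obtain ⟨rfl, rfl⟩ := ih a; exact ⟨rfl, rfl⟩
    | ifFalse h0 _ => omega
  | ifFalse hr _ ih =>
    intro s₂ t₂ h
    cases h with
    | ifTrue h0 _ => omega
    | ifFalse _ a => obtain ⟨rfl, rfl⟩ := ih a; exact ⟨rfl, rfl⟩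
  | whileTrue hr _ _ ih₁ ih₂ =>
    intro s₂ t₂ h
    cases h with
    | whileTrue _ a b =>
      obtain ⟨rfl, rfl⟩ := ih₁ a
      obtain ⟨rfl, rfl⟩ := ih₂ b
      exact ⟨rfl, rfl⟩
    | whileFalse h0 => omega
  | whileFalse hr =>
    intro s₂ t₂ h
    cases h with
    | whileTrue h0 _ _ => omega
    | whileFalse _ => exact ⟨rfl, rfl⟩

/-- The initial state on input `G`: register `0` holds `n`, the memory cells `0, …, n² - 1` hold the
adjacency bits of `G` in row-by-row order, everything else is `0`. -/
def initState {n : ℕ} (G : PairGraph n) : State where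
  reg r := if r = 0 then n else 0
  mem a := if h : a < n * n then (G (finProdFinEquiv.symm ⟨a, h⟩)).toNat else 0

/-- The Boolean function `accept` of graphs is computed in polynomial time: a single program, on
every graph with `n` vertices, halts within `poly(n)` steps and leaves the value of `accept` in
register `0`. -/
def PolyTime (accept : (n : ℕ) → PairGraph n → Bool) : Prop :=
  ∃ (p : Prog) (B : Polynomial ℕ), ∀ (n : ℕ) (G : PairGraph n), ∃ (s : State) (t : ℕ),
    Runs p (initState G) s t ∧ t ≤ B.eval n ∧ s.reg 0 = (accept n G).toNat

/-! ### Certified counts -/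

/-- The bound on the number of `(1 - η)`-satisfying assignments. -/
noncomputable def countBound (n : ℕ) (η : ℝ) : ℝ :=
  if η ≤ 1 / (3 * (n : ℝ)) then 2 else 2 * Real.exp (3 * η * n * Real.log n)

/-- The value that a certification algorithm with the given verdict outputs for parameter `η`:
`countBound n η` if the verdict is to accept, and the trivial bound `2ⁿ` otherwise. -/
noncomputable def certifiedValue (verdict : Bool) (n : ℕ) (η : ℝ) : ℝ :=
  if verdict = true then countBound n η else 2 ^ n

end TwoXor

/-!
The certificate asks for a lower bound on the total degrees and for small entries of the power
`N ^ 2 ^ j`, where `N` is the symmetrized adjacency matrix minus its average, scaled to be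
integral. Since `N ^ 2 ^ j` is a polynomial-size arithmetic expression in the adjacency matrix, the
certificate can be checked in polynomial time.

Soundness: small entries of `N ^ 2 ^ j` bound the quadratic form of `N` (iterate Cauchy–Schwarz), so
that every vertex set `S` with at most half of the vertices sends out a positive proportion of the
edges it would send out in a complete graph. If `S` is the set where two assignments `x` and `x'`
differ, then each edge leaving `S` violates its constraint for `x` or for `x'`; hence two
`(1 - η)`-satisfying assignments are close up to a global sign, and they all lie in two Hamming
balls.

Completeness: put `d = p n = n ^ δ` and `α = n ^ (3 δ / 4)`. By Bernstein's inequality and a union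
bound, degrees are nearly `d` and `|e(S, T) - p |S| |T|| ≤ α √(|S| |T|)` for all `S`, `T` of
comparable sizes; for sizes that are not comparable, near-regularity already gives this bound.
Splitting vectors along the binary digits of their entries, as in the converse expander mixing lemma
of Bilu and Linial, turns this discrepancy into a bound `O(α log n)` (after rescaling) on the action
of `N`, at the cost of one factor `log n` per multiplication. The ratio to `d` is
`n ^ (-δ / 4) log n` up to constants, so its power `K = 2 ^ j ≥ 8 / δ` beats the remaining factors
of `n`.
-/

namespace TwoXor

/-! ### Block sums and the power method -/

section BlockSum

open Finset Matrix

variable {ι κ R : Type*}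

/-- The sum of the entries of `M` with rows in `S` and columns in `T`; for an adjacency matrix, the
number of edges from `S` to `T`. -/
def blockSum [AddCommMonoid R] (M : Matrix ι κ R) (S : Finset ι) (T : Finset κ) : R :=
  ∑ u ∈ S, ∑ v ∈ T, M u v

theorem blockSum_add [AddCommMonoid R] (M N : Matrix ι κ R) (S : Finset ι) (T : Finset κ) :
    blockSum (M + N) S T = blockSum M S T + blockSum N S T := by
  simp [blockSum, sum_add_distrib]

theorem blockSum_transpose [AddCommMonoid R] (M : Matrix ι κ R) (S : Finset ι) (T : Finset κ) :
    blockSum Mᵀ T S = blockSum M S T :=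
  sum_comm

theorem blockSum_add_blockSum_compl [AddCommMonoid R] [Fintype κ] [DecidableEq κ]
    (M : Matrix ι κ R) (S : Finset ι) (T : Finset κ) :
    blockSum M S T + blockSum M S Tᶜ = blockSum M S univ := by
  simp [blockSum, ← sum_add_distrib, sum_add_sum_compl]

theorem blockSum_smul_sub_const [CommRing R] (M : Matrix ι κ R) (a b : R) (S : Finset ι)
    (T : Finset κ) :
    blockSum (a • M - of fun _ _ => b) S T = a * blockSum M S T - b * (#S * #T) := by
  simp only [blockSum, Matrix.sub_apply, Matrix.smul_apply, of_apply, smul_eq_mul, sum_sub_distrib,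
    mul_sum, sum_const, nsmul_eq_mul]
  ring

theorem indicator_dotProduct_mulVec_indicator [Fintype ι] [Fintype κ] [CommRing R]
    (M : Matrix ι κ R) (S : Finset ι) (T : Finset κ) :
    (S : Set ι).indicator 1 ⬝ᵥ M *ᵥ (T : Set κ).indicator 1 = blockSum M S T := by
  classical
  simp [blockSum, dotProduct, mulVec, Set.indicator_apply]

theorem indicator_dotProduct_indicator [Fintype ι] [CommRing R] (S : Finset ι) :
    (S : Set ι).indicator (1 : ι → R) ⬝ᵥ (S : Set ι).indicator 1 = #S := by
  classical
  simp [dotProduct, Set.indicator_apply]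

variable [CommRing R] [LinearOrder R] [IsStrictOrderedRing R]

theorem abs_blockSum_le {M : Matrix ι κ R} {B : R} (hM : ∀ u v, |M u v| ≤ B) (S : Finset ι)
    (T : Finset κ) : |blockSum M S T| ≤ #S * (#T * B) :=
  calc |blockSum M S T| ≤ ∑ u ∈ S, ∑ v ∈ T, |M u v| :=
        (abs_sum_le_sum_abs _ _).trans (sum_le_sum fun _ _ => abs_sum_le_sum_abs _ _)
    _ ≤ ∑ _u ∈ S, ∑ _v ∈ T, B := sum_le_sum fun u _ => sum_le_sum fun v _ => hM u v
    _ = #S * (#T * B) := by simp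

variable [Fintype ι] [DecidableEq ι]

theorem sq_dotProduct_mulVec_pow_le {N : Matrix ι ι R} (hN : N.IsSymm) (f : ι → R) (k : ℕ) :
    (f ⬝ᵥ (N ^ k) *ᵥ f) ^ 2 ≤ (f ⬝ᵥ f) * (f ⬝ᵥ (N ^ (k * 2)) *ᵥ f) := by
  have hsq : f ⬝ᵥ (N ^ (k * 2)) *ᵥ f = (N ^ k) *ᵥ f ⬝ᵥ (N ^ k) *ᵥ f := by
    rw [pow_mul, sq, ← mulVec_mulVec, dotProduct_mulVec, ← mulVec_transpose, (hN.pow k).eq]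
  rw [hsq]
  simpa only [dotProduct, sq] using sum_mul_sq_le_sq_mul_sq univ f ((N ^ k) *ᵥ f)

theorem abs_dotProduct_mulVec_pow_mul_le {N : Matrix ι ι R} (hN : N.IsSymm) (f : ι → R) (j : ℕ) :
    |f ⬝ᵥ N *ᵥ f| ^ 2 ^ j * (f ⬝ᵥ f) ≤ (f ⬝ᵥ f) ^ 2 ^ j * |f ⬝ᵥ (N ^ 2 ^ j) *ᵥ f| := by
  have hnonneg : 0 ≤ f ⬝ᵥ f := sum_nonneg fun i _ => mul_self_nonneg _
  induction j with
  | zero => simp [mul_comm]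
  | succ j ih =>
    rcases hnonneg.eq_or_lt with hzero | hpos
    · simp [← hzero]
    have hstep := sq_dotProduct_mulVec_pow_le hN f (2 ^ j)
    rw [← sq_abs, ← pow_succ] at hstep
    refine le_of_mul_le_mul_right ?_ hpos
    calc |f ⬝ᵥ N *ᵥ f| ^ 2 ^ (j + 1) * (f ⬝ᵥ f) * (f ⬝ᵥ f)
        = (|f ⬝ᵥ N *ᵥ f| ^ 2 ^ j * (f ⬝ᵥ f)) ^ 2 := by rw [pow_succ 2 j, pow_mul]; ring
      _ ≤ ((f ⬝ᵥ f) ^ 2 ^ j * |f ⬝ᵥ (N ^ 2 ^ j) *ᵥ f|) ^ 2 := by gcongr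
      _ = (f ⬝ᵥ f) ^ 2 ^ (j + 1) * |f ⬝ᵥ (N ^ 2 ^ j) *ᵥ f| ^ 2 := by
        rw [pow_succ 2 j, pow_mul]; ring
      _ ≤ (f ⬝ᵥ f) ^ 2 ^ (j + 1) * ((f ⬝ᵥ f) * |f ⬝ᵥ (N ^ 2 ^ (j + 1)) *ᵥ f|) := by
        gcongr
        exact hstep.trans (mul_le_mul_of_nonneg_left (le_abs_self _) hnonneg)
      _ = (f ⬝ᵥ f) ^ 2 ^ (j + 1) * |f ⬝ᵥ (N ^ 2 ^ (j + 1)) *ᵥ f| * (f ⬝ᵥ f) := by ring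

theorem mul_abs_blockSum_le_of_pow_apply_le {N : Matrix ι ι R} (hN : N.IsSymm) {c A : R}
    (hc : 0 ≤ c) (hA : 0 ≤ A) {j : ℕ}
    (hentry : ∀ u v, c ^ 2 ^ j * Fintype.card ι * |(N ^ 2 ^ j) u v| ≤ A ^ 2 ^ j)
    (S : Finset ι) : c * |blockSum N S S| ≤ A * #S := by
  rcases S.eq_empty_or_nonempty with rfl | hS
  · simp [blockSum]
  have hpower := abs_dotProduct_mulVec_pow_mul_le hN ((S : Set ι).indicator 1) j
  simp only [indicator_dotProduct_mulVec_indicator, indicator_dotProduct_indicator] at hpower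
  have hcard_pos : (0 : R) < #S := by exact_mod_cast hS.card_pos
  have hcard_le : (#S : R) ≤ Fintype.card ι := by exact_mod_cast S.card_le_univ
  have hι : (0 : R) < Fintype.card ι := hcard_pos.trans_le hcard_le
  have hblock : c ^ 2 ^ j * Fintype.card ι * |blockSum (N ^ 2 ^ j) S S| ≤
      #S * (#S * A ^ 2 ^ j) := by
    have hscaled : ∀ u v, |((c ^ 2 ^ j * Fintype.card ι) • N ^ 2 ^ j) u v| ≤ A ^ 2 ^ j :=
      fun u v => by
        rw [Matrix.smul_apply, smul_eq_mul, abs_mul, abs_of_nonneg (by positivity)]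
        exact hentry u v
    have := abs_blockSum_le hscaled S S
    simpa [blockSum, ← mul_sum, abs_mul, abs_of_nonneg hc] using this
  refine le_of_pow_le_pow_left₀ (pow_ne_zero j two_ne_zero) (by positivity) ?_
  refine le_of_mul_le_mul_right (a := (Fintype.card ι : R) * #S) ?_ (by positivity)
  calc (c * |blockSum N S S|) ^ 2 ^ j * (Fintype.card ι * #S)
      = c ^ 2 ^ j * Fintype.card ι * (|blockSum N S S| ^ 2 ^ j * #S) := by rw [mul_pow]; ring
    _ ≤ c ^ 2 ^ j * Fintype.card ι * (#S ^ 2 ^ j * |blockSum (N ^ 2 ^ j) S S|) := by gcongr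
    _ = #S ^ 2 ^ j * (c ^ 2 ^ j * Fintype.card ι * |blockSum (N ^ 2 ^ j) S S|) := by ring
    _ ≤ #S ^ 2 ^ j * (#S * (#S * A ^ 2 ^ j)) := by gcongr
    _ ≤ #S ^ 2 ^ j * (#S * (Fintype.card ι * A ^ 2 ^ j)) := by gcongr
    _ = (A * #S) ^ 2 ^ j * (Fintype.card ι * #S) := by rw [mul_pow]; ring

end BlockSum

/-! ### From discrepancy to powers -/

section Discrepancy

open Finset Matrix

variable {ι κ : Type*}

/-- The discrepancy of `M` is at most `β`: its block sums are bounded as if it were an operator of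
norm `β` tested on indicator vectors. -/
def HasDiscrepancyLE (M : Matrix ι κ ℝ) (β : ℝ) : Prop :=
  ∀ (S : Finset ι) (T : Finset κ), |blockSum M S T| ≤ β * √(#S * #T)

variable [Fintype ι] [Fintype κ]

/-- The set of indices `u` for which the binary digit of `x u` at position `b` is `1`. -/
def digitSet (x : ι → ℕ) (b : ℕ) : Finset ι := {u | b ∈ (x u).bitIndices}

theorem natCast_eq_sum_indicator_digitSet {x : ι → ℕ} {L : ℕ} (hx : ∀ u, x u < 2 ^ L) :
    (fun u => (x u : ℝ)) =
      ∑ b ∈ range L, (2 : ℝ) ^ b • (digitSet x b : Set ι).indicator (1 : ι → ℝ) := by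
  classical
  ext u
  have hdigits : (x u).bitIndices.toFinset = {b ∈ range L | u ∈ digitSet x b} := by
    ext b
    simp only [List.mem_toFinset, mem_filter, mem_range, digitSet, mem_univ, true_and, iff_and_self]
    exact fun hb => (Nat.pow_lt_pow_iff_right one_lt_two).1
      ((Nat.two_pow_le_of_mem_bitIndices hb).trans_lt (hx u))
  conv_lhs => rw [← sum_toFinset_bitIndices_two_pow (x u), hdigits, sum_filter]
  simp [Finset.sum_apply, Set.indicator_apply]

theorem sum_sq_two_pow_mul_sqrt_card_digitSet_le {x : ι → ℕ} {L : ℕ} (hx : ∀ u, x u < 2 ^ L) :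
    ∑ b ∈ range L, (2 ^ b * √(#(digitSet x b))) ^ 2 ≤
      (fun u => (x u : ℝ)) ⬝ᵥ fun u => (x u : ℝ) := by
  classical
  have hdigits (u : ι) : (x u : ℝ) = ∑ b ∈ range L, if u ∈ digitSet x b then 2 ^ b else 0 := by
    simpa [Finset.sum_apply, Set.indicator_apply] using
      congrFun (natCast_eq_sum_indicator_digitSet hx) u
  calc ∑ b ∈ range L, (2 ^ b * √(#(digitSet x b))) ^ 2
      = ∑ u, ∑ b ∈ range L, (if u ∈ digitSet x b then (2 : ℝ) ^ b else 0) ^ 2 := by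
        rw [sum_comm]
        refine sum_congr rfl fun b _ => ?_
        rw [mul_pow, Real.sq_sqrt (Nat.cast_nonneg _)]
        simp [ite_pow, mul_comm]
    _ ≤ ∑ u, (∑ b ∈ range L, if u ∈ digitSet x b then (2 : ℝ) ^ b else 0) ^ 2 :=
        sum_le_sum fun u _ => sum_sq_le_sq_sum_of_nonneg fun b _ => by positivity
    _ = (fun u => (x u : ℝ)) ⬝ᵥ fun u => (x u : ℝ) := by
        simp only [dotProduct, ← hdigits, sq]

theorem sum_two_pow_mul_sqrt_card_digitSet_le {x : ι → ℕ} {L : ℕ} (hx : ∀ u, x u < 2 ^ L) :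
    ∑ b ∈ range L, 2 ^ b * √(#(digitSet x b)) ≤
      √L * √((fun u => (x u : ℝ)) ⬝ᵥ fun u => (x u : ℝ)) := by
  rw [← Real.sqrt_mul (Nat.cast_nonneg L)]
  refine Real.le_sqrt_of_sq_le (sq_sum_le_card_mul_sum_sq.trans ?_)
  rw [card_range]
  gcongr
  exact sum_sq_two_pow_mul_sqrt_card_digitSet_le hx

variable {M : Matrix ι κ ℝ} {β : ℝ}

theorem natCast_dotProduct_mulVec_natCast {x : ι → ℕ} {y : κ → ℕ} {L : ℕ} (M : Matrix ι κ ℝ)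
    (hx : ∀ u, x u < 2 ^ L) (hy : ∀ v, y v < 2 ^ L) :
    (fun u => (x u : ℝ)) ⬝ᵥ M *ᵥ (fun v => (y v : ℝ)) =
      ∑ b ∈ range L, ∑ c ∈ range L, 2 ^ c * (2 ^ b * blockSum M (digitSet x b) (digitSet y c)) := by
  rw [natCast_eq_sum_indicator_digitSet hx, natCast_eq_sum_indicator_digitSet hy, sum_dotProduct]
  simp only [mulVec_sum, dotProduct_sum, smul_dotProduct, mulVec_smul, dotProduct_smul,
    smul_eq_mul, indicator_dotProduct_mulVec_indicator]

theorem HasDiscrepancyLE.abs_natCast_dotProduct_mulVec_le (hM : HasDiscrepancyLE M β) (hβ : 0 ≤ β)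
    {x : ι → ℕ} {y : κ → ℕ} {L : ℕ} (hx : ∀ u, x u < 2 ^ L) (hy : ∀ v, y v < 2 ^ L) :
    |(fun u => (x u : ℝ)) ⬝ᵥ M *ᵥ fun v => (y v : ℝ)| ≤
      β * L * (√((fun u => (x u : ℝ)) ⬝ᵥ fun u => (x u : ℝ)) *
        √((fun v => (y v : ℝ)) ⬝ᵥ fun v => (y v : ℝ))) := by
  have hblock : ∀ b c, |2 ^ c * (2 ^ b * blockSum M (digitSet x b) (digitSet y c))| ≤
      β * ((2 ^ b * √(#(digitSet x b))) * (2 ^ c * √(#(digitSet y c)))) := fun b c =>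
    calc _ = 2 ^ c * (2 ^ b * |blockSum M (digitSet x b) (digitSet y c)|) := by simp [abs_mul]
      _ ≤ 2 ^ c * (2 ^ b * (β * √(#(digitSet x b) * #(digitSet y c)))) := by
        gcongr
        exact hM _ _
      _ = _ := by rw [Real.sqrt_mul (Nat.cast_nonneg _)]; ring
  have hX := sum_two_pow_mul_sqrt_card_digitSet_le hx
  have hY := sum_two_pow_mul_sqrt_card_digitSet_le hy
  rw [natCast_dotProduct_mulVec_natCast M hx hy]
  generalize √((fun u => (x u : ℝ)) ⬝ᵥ fun u => (x u : ℝ)) = X at hX ⊢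
  generalize √((fun v => (y v : ℝ)) ⬝ᵥ fun v => (y v : ℝ)) = Y at hY ⊢
  calc _ ≤ ∑ b ∈ range L, ∑ c ∈ range L,
          |2 ^ c * (2 ^ b * blockSum M (digitSet x b) (digitSet y c))| :=
        (abs_sum_le_sum_abs _ _).trans (sum_le_sum fun _ _ => abs_sum_le_sum_abs _ _)
    _ ≤ ∑ b ∈ range L, ∑ c ∈ range L,
          β * ((2 ^ b * √(#(digitSet x b))) * (2 ^ c * √(#(digitSet y c)))) :=
        sum_le_sum fun b _ => sum_le_sum fun c _ => hblock b c
    _ = β * ((∑ b ∈ range L, 2 ^ b * √(#(digitSet x b))) *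
          ∑ c ∈ range L, 2 ^ c * √(#(digitSet y c))) := by
        rw [sum_mul_sum]
        simp only [mul_sum]
    _ ≤ β * ((√L * X) * (√L * Y)) := by
        gcongr
        exact (sum_nonneg fun b _ => by positivity).trans hX
    _ = β * (√L * √L) * (X * Y) := by ring
    _ = β * L * (X * Y) := by rw [Real.mul_self_sqrt (Nat.cast_nonneg L)]

theorem exists_natCast_sub_natCast_eq {x : ι → ℤ} {L : ℕ} (hx : ∀ u, |x u| < 2 ^ L) :
    ∃ p q : ι → ℕ, ((fun u => (x u : ℝ)) = (fun u => (p u : ℝ)) - fun u => (q u : ℝ)) ∧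
      ∀ r ∈ ({p, q} : Set (ι → ℕ)), (∀ u, r u < 2 ^ L) ∧
        √((fun u => (r u : ℝ)) ⬝ᵥ fun u => (r u : ℝ)) ≤
          √((fun u => (x u : ℝ)) ⬝ᵥ fun u => (x u : ℝ)) := by
  have hbound : ∀ r : ι → ℕ, (∀ u, r u ≤ (x u).natAbs) → (∀ u, r u < 2 ^ L) ∧
      √((fun u => (r u : ℝ)) ⬝ᵥ fun u => (r u : ℝ)) ≤
        √((fun u => (x u : ℝ)) ⬝ᵥ fun u => (x u : ℝ)) := by
    refine fun r hr => ⟨fun u => (hr u).trans_lt ?_,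
      Real.sqrt_le_sqrt (sum_le_sum fun u _ => ?_)⟩
    · have := hx u
      rw [Int.abs_eq_natAbs] at this
      exact_mod_cast this
    · have hle : (r u : ℝ) ≤ |(x u : ℝ)| := by
        rw [← Int.cast_abs, Int.abs_eq_natAbs]
        exact_mod_cast hr u
      rw [← abs_mul_abs_self (x u : ℝ)]
      gcongr
  refine ⟨fun u => (x u).toNat, fun u => (-x u).toNat, ?_, ?_⟩
  · ext u
    have hsplit : x u = ((x u).toNat : ℤ) - ((-x u).toNat : ℤ) := (Int.toNat_sub_toNat_neg _).symm
    exact (congrArg (Int.cast : ℤ → ℝ) hsplit).trans (by push_cast; rfl)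
  · rintro r (rfl | rfl)
    exacts [hbound _ fun u => by omega, hbound _ fun u => by omega]

theorem HasDiscrepancyLE.abs_intCast_dotProduct_mulVec_le (hM : HasDiscrepancyLE M β) (hβ : 0 ≤ β)
    {x : ι → ℤ} {y : κ → ℤ} {L : ℕ} (hx : ∀ u, |x u| < 2 ^ L) (hy : ∀ v, |y v| < 2 ^ L) :
    |(fun u => (x u : ℝ)) ⬝ᵥ M *ᵥ fun v => (y v : ℝ)| ≤
      4 * β * L * (√((fun u => (x u : ℝ)) ⬝ᵥ fun u => (x u : ℝ)) *
        √((fun v => (y v : ℝ)) ⬝ᵥ fun v => (y v : ℝ))) := by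
  obtain ⟨x₁, x₂, hx_eq, hx_le⟩ := exists_natCast_sub_natCast_eq hx
  obtain ⟨y₁, y₂, hy_eq, hy_le⟩ := exists_natCast_sub_natCast_eq hy
  set X := √((fun u => (x u : ℝ)) ⬝ᵥ fun u => (x u : ℝ))
  set Y := √((fun v => (y v : ℝ)) ⬝ᵥ fun v => (y v : ℝ))
  have hpart : ∀ p ∈ ({x₁, x₂} : Set (ι → ℕ)), ∀ q ∈ ({y₁, y₂} : Set (κ → ℕ)),
      |(fun u => (p u : ℝ)) ⬝ᵥ M *ᵥ fun v => (q v : ℝ)| ≤ β * L * (X * Y) := fun p hp q hq => by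
    refine (hM.abs_natCast_dotProduct_mulVec_le hβ (hx_le p hp).1 (hy_le q hq).1).trans ?_
    gcongr
    exacts [(hx_le p hp).2, (hy_le q hq).2]
  rw [hx_eq, hy_eq, mulVec_sub, sub_dotProduct, dotProduct_sub, dotProduct_sub]
  refine ((abs_sub _ _).trans (add_le_add (abs_sub _ _) (abs_sub _ _))).trans ?_
  linarith [hpart x₁ (by simp) y₁ (by simp), hpart x₁ (by simp) y₂ (by simp),
    hpart x₂ (by simp) y₁ (by simp), hpart x₂ (by simp) y₂ (by simp)]

theorem HasDiscrepancyLE.sqrt_intCast_mulVec_le {N : Matrix ι κ ℤ}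
    (hN : HasDiscrepancyLE (N.map Int.cast) β) (hβ : 0 ≤ β) {y : κ → ℤ} {L : ℕ}
    (hNy : ∀ u, |(N *ᵥ y) u| < 2 ^ L) (hy : ∀ v, |y v| < 2 ^ L) :
    √((fun u => ((N *ᵥ y) u : ℝ)) ⬝ᵥ fun u => ((N *ᵥ y) u : ℝ)) ≤
      4 * β * L * √((fun v => (y v : ℝ)) ⬝ᵥ fun v => (y v : ℝ)) := by
  have hcast : (N.map Int.cast *ᵥ fun v => (y v : ℝ)) = fun u => ((N *ᵥ y) u : ℝ) :=
    funext fun u => ((Int.castRingHom ℝ).map_mulVec N y u).symm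
  have hform := hN.abs_intCast_dotProduct_mulVec_le hβ hNy hy
  have hnonneg : 0 ≤ (fun u => ((N *ᵥ y) u : ℝ)) ⬝ᵥ fun u => ((N *ᵥ y) u : ℝ) :=
    sum_nonneg fun u _ => mul_self_nonneg _
  rw [hcast, abs_of_nonneg hnonneg] at hform
  nth_rw 1 [← Real.mul_self_sqrt hnonneg] at hform
  rcases (Real.sqrt_nonneg ((fun u => ((N *ᵥ y) u : ℝ)) ⬝ᵥ fun u => ((N *ᵥ y) u : ℝ))).eq_or_lt
    with hzero | hpos
  · rw [← hzero]
    positivity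
  · refine le_of_mul_le_mul_left ?_ hpos
    linarith

theorem abs_pow_apply_le_of_abs_apply_le {R : Type*} [CommRing R] [LinearOrder R]
    [IsStrictOrderedRing R] [DecidableEq ι] {N : Matrix ι ι R} {B : R} (hN : ∀ u v, |N u v| ≤ B)
    (k : ℕ) (u v : ι) : |(N ^ k) u v| ≤ (Fintype.card ι * B) ^ k := by
  induction k generalizing u with
  | zero =>
    rw [pow_zero, pow_zero, Matrix.one_apply]
    split_ifs <;> simp
  | succ k ih =>
    have hB : 0 ≤ B := (abs_nonneg _).trans (hN u v)
    rw [pow_succ', Matrix.mul_apply]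
    calc |∑ w, N u w * (N ^ k) w v| ≤ ∑ w, |N u w * (N ^ k) w v| := abs_sum_le_sum_abs _ _
      _ ≤ ∑ _w : ι, B * (Fintype.card ι * B) ^ k := sum_le_sum fun w _ => by
        rw [abs_mul]
        exact mul_le_mul (hN u w) (ih w) (abs_nonneg _) hB
      _ = (Fintype.card ι * B) ^ (k + 1) := by
        rw [sum_const, card_univ, nsmul_eq_mul, pow_succ']
        ring

/-- The bound `hL` on the size of the entries keeps the number of binary digits, and with it the
loss in passing from indicator vectors to integer vectors, at most `L`. -/
theorem HasDiscrepancyLE.abs_pow_apply_le [DecidableEq ι] {N : Matrix ι ι ℤ}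
    (hN : HasDiscrepancyLE (N.map Int.cast) β) (hβ : 0 ≤ β) {B : ℤ} (hB : 1 ≤ B)
    (hNB : ∀ u v, |N u v| ≤ B) {L K : ℕ} (hL : (Fintype.card ι * B) ^ K < 2 ^ L) (u v : ι) :
    |((N ^ K) u v : ℝ)| ≤ (4 * β * L) ^ K := by
  have hι : (1 : ℤ) ≤ Fintype.card ι := by exact_mod_cast Fintype.card_pos_iff.2 ⟨u⟩
  have hsmall : ∀ i ≤ K, ∀ w, |(N ^ i) w v| < 2 ^ L := fun i hi w =>
    ((abs_pow_apply_le_of_abs_apply_le hNB i w v).trans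
      (pow_le_pow_right₀ (one_le_mul_of_one_le_of_one_le hι hB) hi)).trans_lt hL
  have hcol : ∀ i, (fun w => (N ^ (i + 1)) w v) = N *ᵥ fun w => (N ^ i) w v := fun i =>
    funext fun w => by rw [pow_succ', Matrix.mul_apply]; rfl
  have hnorm : ∀ i ≤ K, √((fun w => ((N ^ i) w v : ℝ)) ⬝ᵥ fun w => ((N ^ i) w v : ℝ)) ≤
      (4 * β * L) ^ i := by
    intro i hi
    induction i with
    | zero => simp [dotProduct, Matrix.one_apply]
    | succ i ih =>
      have hmulVec := hN.sqrt_intCast_mulVec_le hβ (hcol i ▸ hsmall (i + 1) hi)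
        (hsmall i (by omega))
      rw [← hcol i] at hmulVec
      rw [pow_succ' (4 * β * L)]
      exact hmulVec.trans (mul_le_mul_of_nonneg_left (ih (by omega)) (by positivity))
  refine (Real.abs_le_sqrt ?_).trans (hnorm K le_rfl)
  rw [sq]
  exact single_le_sum (f := fun w => ((N ^ K) w v : ℝ) * (N ^ K) w v)
    (fun w _ => mul_self_nonneg _) (mem_univ u)

end Discrepancy

/-! ### Concentration of Bernoulli sums -/

section Concentration

open Finset Real

variable {ι : Type*}

/-- The number of `true` coordinates of `G` in `E`, centred at its expectation when each coordinate
is `true` with probability `p`. -/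
noncomputable def excess (p : ℝ) (E : Finset ι) (G : ι → Bool) : ℝ :=
  ∑ e ∈ E, ((if G e = true then 1 else 0) - p)

/-- The law of a family of independent bits indexed by `ι`, each `true` with probability `p`. -/
noncomputable abbrev bernoulliPi (ι : Type*) [Fintype ι] (p : unitInterval) : Measure (ι → Bool) :=
  Measure.pi fun _ => ProbabilityTheory.bernoulliMeasure true false p

theorem integral_exp_mul_bernoulli_sub_le (p : unitInterval) {θ : ℝ} (hθ : |θ| ≤ 1) :
    ∫ b, exp (θ * ((if b = true then 1 else 0) - (p : ℝ)))
      ∂(ProbabilityTheory.bernoulliMeasure true false p) ≤ exp (p * θ ^ 2) := by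
  have hexpect : ∫ b, exp (θ * ((if b = true then 1 else 0) - (p : ℝ)))
      ∂(ProbabilityTheory.bernoulliMeasure true false p) =
        p * exp (θ * (1 - p)) + (1 - p) * exp (θ * (0 - p)) := by
    rw [integral_fintype Integrable.of_finite]
    simp [ProbabilityTheory.bernoulliMeasure_real_apply]
  have htaylor : exp θ - 1 - θ ≤ θ ^ 2 := (abs_le.1 (abs_exp_sub_one_sub_id_le hθ)).2
  have hp : (0 : ℝ) ≤ p := p.2.1
  rw [hexpect]
  calc (p : ℝ) * exp (θ * (1 - p)) + (1 - p) * exp (θ * (0 - p))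
      = (p * (exp θ - 1) + 1) * exp (-(θ * p)) := by
        rw [show θ * (1 - (p : ℝ)) = θ + -(θ * p) by ring, exp_add,
          show θ * (0 - (p : ℝ)) = -(θ * p) by ring]
        ring
    _ ≤ exp (p * (exp θ - 1)) * exp (-(θ * p)) := by
        gcongr
        exact add_one_le_exp _
    _ = exp (p * (exp θ - 1 - θ)) := by rw [← exp_add]; ring_nf
    _ ≤ exp (p * θ ^ 2) := by gcongr

variable [Fintype ι]

theorem integral_exp_mul_excess_le (p : unitInterval) (E : Finset ι) {θ : ℝ} (hθ : |θ| ≤ 1) :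
    ∫ G, exp (θ * excess p E G) ∂(bernoulliPi ι p) ≤ exp (#E * (p * θ ^ 2)) := by
  classical
  have hprod : ∀ G : ι → Bool, exp (θ * excess p E G) =
      ∏ e, if e ∈ E then exp (θ * ((if G e = true then 1 else 0) - (p : ℝ))) else 1 := fun G => by
    rw [excess, mul_sum, exp_sum]
    simp
  simp only [hprod]
  rw [integral_fintype_prod_eq_prod (fun e b =>
    if e ∈ E then exp (θ * ((if b = true then 1 else 0) - (p : ℝ))) else 1)]
  calc _ ≤ ∏ e, if e ∈ E then exp (p * θ ^ 2) else 1 := by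
        refine prod_le_prod (fun e _ => integral_nonneg fun b => ?_) fun e _ => ?_
        · change 0 ≤ ite _ _ _
          positivity
        · by_cases he : e ∈ E
          · simpa only [he, if_true] using integral_exp_mul_bernoulli_sub_le p hθ
          · simp [he]
    _ = exp (#E * (p * θ ^ 2)) := by simp [exp_nat_mul]

theorem measure_le_mul_excess_le (p : unitInterval) (E : Finset ι) {θ : ℝ} (hθ : |θ| ≤ 1) (a : ℝ) :
    (bernoulliPi ι p).real {G | a ≤ θ * excess p E G} ≤ exp (#E * (p * θ ^ 2) - a) := by
  have hmarkov := mul_meas_ge_le_integral_of_nonneg (μ := bernoulliPi ι p)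
    (f := fun G => exp (θ * excess p E G)) (ae_of_all _ fun G => (exp_pos _).le)
    Integrable.of_finite (exp a)
  simp only [exp_le_exp] at hmarkov
  rw [exp_sub, le_div_iff₀ (exp_pos a), mul_comm]
  exact hmarkov.trans (integral_exp_mul_excess_le p E hθ)

theorem exists_mul_sq_sub_mul_le_neg {v l q : ℝ} (hl : 0 ≤ l) (hql : q ≤ l / 2)
    (hqv : 4 * v * q ≤ l ^ 2) : ∃ θ, 0 ≤ θ ∧ θ ≤ 1 ∧ v * θ ^ 2 - θ * l ≤ -q := by
  rcases le_or_gt l (2 * v) with hlv | hlv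
  · rcases (by linarith : 0 ≤ v).eq_or_lt with rfl | hv
    · exact ⟨0, le_rfl, zero_le_one, by linarith⟩
    refine ⟨l / (2 * v), by positivity, (div_le_one (by positivity)).2 hlv, ?_⟩
    have hvalue : v * (l / (2 * v)) ^ 2 - l / (2 * v) * l = -(l ^ 2 / (4 * v)) := by
      field_simp
      norm_num
    rw [hvalue, neg_le_neg_iff, le_div_iff₀ (by positivity)]
    linarith
  · exact ⟨1, zero_le_one, le_rfl, by linarith⟩

theorem measure_lt_abs_excess_le (p : unitInterval) (E : Finset ι) {l q : ℝ} (hl : 0 ≤ l)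
    (hql : q ≤ l / 2) (hqv : 4 * (#E * (p : ℝ)) * q ≤ l ^ 2) :
    (bernoulliPi ι p).real {G | l < |excess p E G|} ≤ 2 * exp (-q) := by
  obtain ⟨θ, hθ₀, hθ₁, hθ⟩ := exists_mul_sq_sub_mul_le_neg hl hql hqv
  have htail : ∀ σ : ℝ, |σ| = θ →
      (bernoulliPi ι p).real {G | θ * l ≤ σ * excess p E G} ≤ exp (-q) := fun σ hσ => by
    refine (measure_le_mul_excess_le p E (hσ.trans_le hθ₁) _).trans (exp_le_exp.2 ?_)
    rwa [← sq_abs, hσ, ← mul_assoc]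
  have hsub : {G | l < |excess p E G|} ⊆
      {G | θ * l ≤ θ * excess p E G} ∪ {G | θ * l ≤ (-θ) * excess p E G} := fun G hG => by
    rcases lt_abs.1 (show l < |excess p E G| from hG) with hpos | hneg
    · exact .inl (mul_le_mul_of_nonneg_left hpos.le hθ₀)
    · exact .inr ((mul_le_mul_of_nonneg_left hneg.le hθ₀).trans_eq (neg_mul_comm _ _).symm)
  calc _ ≤ _ := measureReal_mono hsub
    _ ≤ _ := measureReal_union_le _ _
    _ ≤ exp (-q) + exp (-q) :=
      add_le_add (htail θ (abs_of_nonneg hθ₀)) (htail (-θ) (by rw [abs_neg, abs_of_nonneg hθ₀]))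
    _ = 2 * exp (-q) := (two_mul _).symm

end Concentration

/-! ### Expressions computed by the machine in polynomial time -/

/-- A quantity depending on the input size, the memory and an environment of further variables. -/
abbrev Term : Type := ℕ → (ℕ → ℕ) → (ℕ → ℕ) → ℕ

/-- The environment `env` extended by a new variable `0` of value `w`; the others are shifted. -/
def consEnv (w : ℕ) (env : ℕ → ℕ) : ℕ → ℕ
  | 0 => w
  | i + 1 => env i

/-- The scale in which polynomial bounds are expressed: the memory holds bits, and the input size
and the variables are at most `X`. -/
structure InputsLE (n : ℕ) (m env : ℕ → ℕ) (X : ℕ) : Prop where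
  mem_le_one : ∀ a, m a ≤ 1
  size_le : n ≤ X
  env_le : ∀ i, env i ≤ X

/-- The values of `f` are polynomially bounded in the input size and the variables. -/
def PolyBounded (f : Term) : Prop :=
  ∃ B : Polynomial ℕ, ∀ n m env X, InputsLE n m env X → f n m env ≤ B.eval X

/-- The states `s` and `s'` have the same memory and the same contents of the registers
below `d`. -/
structure State.AgreeBelow (d : ℕ) (s s' : State) : Prop where
  mem_eq : s'.mem = s.mem
  reg_eq : ∀ i < d, s'.reg i = s.reg i

/-- Started in `s`, the program `p` computes `v` into register `d` within `T` steps, without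
changing the memory and the registers below `d`. -/
def Computes (p : Prog) (d : ℕ) (s : State) (v T : ℕ) : Prop :=
  ∃ s' t, Runs p s s' t ∧ t ≤ T ∧ s.AgreeBelow d s' ∧ s'.reg d = v

/-- A polynomially bounded quantity which, wherever its variables sit among the registers below
`d`, some program computes into register `d` in polynomial time.  Register `0` holds the input
size, and `σ i` is the register of the variable `i`. -/
structure PolyComputable (f : Term) : Prop where
  polyBounded : PolyBounded f
  exists_prog : ∀ (d : ℕ) (σ : ℕ → ℕ), 0 < d → (∀ i, σ i < d) →
    ∃ (p : Prog) (B : Polynomial ℕ), ∀ s X, InputsLE (s.reg 0) s.mem (s.reg ∘ σ) X →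
      Computes p d s (f (s.reg 0) s.mem (s.reg ∘ σ)) (B.eval X)

theorem State.setReg_reg (s : State) (d v i : ℕ) :
    (s.setReg d v).reg i = if i = d then v else s.reg i := by
  simp [State.setReg, Function.update_apply]

namespace State.AgreeBelow

variable {d e : ℕ} {s s' s'' : State}

theorem trans (h : s.AgreeBelow d s') (h' : s'.AgreeBelow d s'') : s.AgreeBelow d s'' :=
  ⟨h'.mem_eq.trans h.mem_eq, fun i hi => (h'.reg_eq i hi).trans (h.reg_eq i hi)⟩

theorem mono (hde : d ≤ e) (h : s.AgreeBelow e s') : s.AgreeBelow d s' :=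
  ⟨h.mem_eq, fun i hi => h.reg_eq i (hi.trans_le hde)⟩

theorem setReg (h : s.AgreeBelow d s') (hde : d ≤ e) (v : ℕ) : s.AgreeBelow d (s'.setReg e v) :=
  ⟨h.mem_eq, fun i hi => by rw [setReg_reg, if_neg (by omega), h.reg_eq i hi]⟩

theorem reg_comp_eq {σ : ℕ → ℕ} (h : s.AgreeBelow d s') (hσ : ∀ i, σ i < d) :
    s'.reg ∘ σ = s.reg ∘ σ :=
  funext fun i => h.reg_eq _ (hσ i)

end State.AgreeBelow

theorem State.agreeBelow_refl (d : ℕ) (s : State) : s.AgreeBelow d s :=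
  ⟨rfl, fun _ _ => rfl⟩

theorem computes_copyReg {d r : ℕ} (hr : r < d) (s : State) :
    Computes (.seq (.const d 0) (.add d d r)) d s (s.reg r) 2 :=
  ⟨_, _, .seq (.const s d 0) (.add _ d d r), le_rfl,
    ((s.agreeBelow_refl d).setReg le_rfl _).setReg le_rfl _, by simp [State.setReg_reg, hr.ne]⟩

/-- One round of the loop that computes a bounded sum whose terms are computed by `q`: register `d`
is the accumulator, `d + 1` counts down, `d + 2` is the summation index. -/
def sumBody (d : ℕ) (q : Prog) : Prog :=
  .seq q (.seq (.add d d (d + 3)) (.seq (.const (d + 3) 1)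
    (.seq (.add (d + 2) (d + 2) (d + 3)) (.sub (d + 1) (d + 1) (d + 3)))))

theorem runs_sumBody {d v T : ℕ} {q : Prog} {s : State} (hq : Computes q (d + 3) s v T) :
    ∃ s' t, Runs (sumBody d q) s s' t ∧ t ≤ T + 4 ∧ s.AgreeBelow d s' ∧
      s'.reg d = s.reg d + v ∧ s'.reg (d + 1) = s.reg (d + 1) - 1 ∧
      s'.reg (d + 2) = s.reg (d + 2) + 1 := by
  obtain ⟨s₁, t, hrun, ht, hagree, hv⟩ := hq
  refine ⟨_, _, .seq hrun (.seq (.add _ _ _ _) (.seq (.const _ _ _) (.seq (.add _ _ _ _)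
    (.sub _ _ _ _)))), by omega, ?_, ?_, ?_, ?_⟩
  · exact ((((hagree.mono (by omega)).setReg le_rfl _).setReg (by omega) _).setReg
      (by omega) _).setReg (by omega) _
  · simp [State.setReg_reg, hv, hagree.reg_eq d (by omega)]
  · simp [State.setReg_reg, hagree.reg_eq (d + 1) (by omega)]
  · simp [State.setReg_reg, hagree.reg_eq (d + 2) (by omega)]

theorem computes_sumLoop {d T N : ℕ} {q : Prog} {s₀ : State} {v : ℕ → ℕ}
    (hq : ∀ s, s₀.AgreeBelow d s → s.reg (d + 2) < N → Computes q (d + 3) s (v (s.reg (d + 2))) T)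
    (r : ℕ) : ∀ s, s₀.AgreeBelow d s → s.reg (d + 1) = r → s.reg (d + 2) + r = N →
      Computes (.whilePos (d + 1) (sumBody d q)) d s
        (s.reg d + ∑ j ∈ Finset.range r, v (s.reg (d + 2) + j)) (r * (T + 5) + 1) := by
  induction r with
  | zero =>
    intro s _ hcount _
    exact ⟨s, 1, .whileFalse hcount, by simp, s.agreeBelow_refl d, by simp⟩
  | succ r ih =>
    intro s hs hcount hindex
    obtain ⟨s₁, t₁, hrun₁, ht₁, hagree₁, hacc, hcount₁, hindex₁⟩ :=
      runs_sumBody (hq s hs (by omega))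
    obtain ⟨s₂, t₂, hrun₂, ht₂, hagree₂, hval⟩ :=
      ih s₁ (hs.trans hagree₁) (by omega) (by omega)
    refine ⟨s₂, _, .whileTrue (by omega) hrun₁ hrun₂, ?_, hagree₁.trans hagree₂, ?_⟩
    · rw [add_one_mul]
      omega
    · rw [hval, hacc, hindex₁, Finset.sum_range_succ', add_zero]
      simp only [add_assoc, add_comm 1]
      rw [add_comm (v _)]

theorem InputsLE.consEnv {n N w X Y : ℕ} {m env : ℕ → ℕ} (h : InputsLE n m env X) (hN : N ≤ Y)
    (hw : w < N) : InputsLE n m (consEnv w env) (X + Y) where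
  mem_le_one := h.mem_le_one
  size_le := h.size_le.trans (Nat.le_add_right _ _)
  env_le
    | 0 => (hw.le.trans hN).trans (Nat.le_add_left _ _)
    | i + 1 => (h.env_le i).trans (Nat.le_add_right _ _)

namespace PolyBounded

variable {f g : Term}

theorem of_le_add (hf : PolyBounded f) (hg : PolyBounded g) {h : Term}
    (hh : ∀ n m env, h n m env ≤ f n m env + g n m env) : PolyBounded h := by
  obtain ⟨B, hB⟩ := hf
  obtain ⟨C, hC⟩ := hg
  refine ⟨B + C, fun n m env X hX => (hh n m env).trans ?_⟩
  rw [Polynomial.eval_add]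
  exact add_le_add (hB n m env X hX) (hC n m env X hX)

theorem sum (hf : PolyBounded f) (hg : PolyBounded g) :
    PolyBounded fun n m env => ∑ w ∈ Finset.range (f n m env), g n m (consEnv w env) := by
  obtain ⟨B, hB⟩ := hf
  obtain ⟨C, hC⟩ := hg
  refine ⟨B * C.comp (Polynomial.X + B), fun n m env X hX => ?_⟩
  simp only [Polynomial.eval_mul, Polynomial.eval_comp, Polynomial.eval_add, Polynomial.eval_X]
  calc ∑ w ∈ Finset.range (f n m env), g n m (consEnv w env)
      ≤ ∑ _w ∈ Finset.range (f n m env), C.eval (X + B.eval X) :=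
        Finset.sum_le_sum fun w hw =>
          hC n m _ _ (hX.consEnv (hB n m env X hX) (Finset.mem_range.1 hw))
    _ ≤ B.eval X * C.eval (X + B.eval X) := by
        rw [Finset.sum_const, Finset.card_range, smul_eq_mul]
        exact Nat.mul_le_mul_right _ (hB n m env X hX)

end PolyBounded

namespace PolyComputable

variable {f g : Term}

theorem const (c : ℕ) : PolyComputable fun _ _ _ => c where
  polyBounded := ⟨Polynomial.C c, fun _ _ _ _ _ => by simp⟩
  exists_prog d σ _ _ := ⟨.const d c, 1, fun s _ _ => ⟨_, _, .const s d c, by simp,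
    (s.agreeBelow_refl d).setReg le_rfl _, by simp [State.setReg_reg]⟩⟩

theorem size : PolyComputable fun n _ _ => n where
  polyBounded := ⟨Polynomial.X, fun _ _ _ _ hX => by simpa using hX.size_le⟩
  exists_prog d _ hd _ := ⟨_, 2, fun s _ _ => by simpa using computes_copyReg hd s⟩

theorem var (j : ℕ) : PolyComputable fun _ _ env => env j where
  polyBounded := ⟨Polynomial.X, fun _ _ _ _ hX => by simpa using hX.env_le j⟩
  exists_prog d _ _ hσ := ⟨_, 2, fun s _ _ => by simpa using computes_copyReg (hσ j) s⟩

theorem mem (hf : PolyComputable f) : PolyComputable fun n m env => m (f n m env) where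
  polyBounded := ⟨1, fun _ _ _ _ hX => by simpa using hX.mem_le_one _⟩
  exists_prog d σ hd hσ := by
    obtain ⟨p, B, hp⟩ := hf.exists_prog d σ hd hσ
    refine ⟨.seq p (.load d d), B + 1, fun s X hX => ?_⟩
    obtain ⟨s', t, hrun, ht, hagree, hval⟩ := hp s X hX
    refine ⟨_, _, .seq hrun (.load s' d d), ?_, hagree.setReg le_rfl _, ?_⟩
    · simpa using ht
    · simp [State.setReg_reg, hval, hagree.mem_eq]

theorem binary {op : ℕ → ℕ → ℕ} (hop : ∀ a b, op a b ≤ a + b) {instr : ℕ → ℕ → ℕ → Prog}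
    (hinstr : ∀ (s : State) (d a b : ℕ),
      Runs (instr d a b) s (s.setReg d (op (s.reg a) (s.reg b))) 1)
    (hf : PolyComputable f) (hg : PolyComputable g) :
    PolyComputable fun n m env => op (f n m env) (g n m env) where
  polyBounded := hf.polyBounded.of_le_add hg.polyBounded fun _ _ _ => hop _ _
  exists_prog d σ hd hσ := by
    obtain ⟨p, B, hp⟩ := hf.exists_prog d σ hd hσ
    obtain ⟨q, C, hq⟩ := hg.exists_prog (d + 1) σ d.succ_pos fun i => (hσ i).trans d.lt_succ_self
    refine ⟨.seq p (.seq q (instr d d (d + 1))), B + C + 1, fun s X hX => ?_⟩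
    obtain ⟨s₁, t₁, hrun₁, ht₁, hagree₁, hval₁⟩ := hp s X hX
    have hq₁ := hq s₁ X
    rw [hagree₁.mem_eq, hagree₁.reg_eq 0 hd, hagree₁.reg_comp_eq hσ] at hq₁
    obtain ⟨s₂, t₂, hrun₂, ht₂, hagree₂, hval₂⟩ := hq₁ hX
    refine ⟨_, _, .seq hrun₁ (.seq hrun₂ (hinstr s₂ d d (d + 1))), ?_,
      (hagree₁.trans (hagree₂.mono d.le_succ)).setReg le_rfl _, ?_⟩
    · simp only [Polynomial.eval_add, Polynomial.eval_one]
      omega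
    · rw [State.setReg_reg, if_pos rfl, hval₂, hagree₂.reg_eq d d.lt_succ_self, hval₁]

theorem add (hf : PolyComputable f) (hg : PolyComputable g) :
    PolyComputable fun n m env => f n m env + g n m env :=
  binary (fun _ _ => le_rfl) .add hf hg

theorem sub (hf : PolyComputable f) (hg : PolyComputable g) :
    PolyComputable fun n m env => f n m env - g n m env :=
  binary (fun _ _ => (Nat.sub_le _ _).trans (Nat.le_add_right _ _)) .sub hf hg

theorem shift (hf : PolyComputable f) :
    PolyComputable fun n m env => f n m fun i => env (i + 1) where
  polyBounded := by
    obtain ⟨B, hB⟩ := hf.polyBounded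
    exact ⟨B, fun n m env X hX =>
      hB n m _ X ⟨hX.mem_le_one, hX.size_le, fun i => hX.env_le (i + 1)⟩⟩
  exists_prog d σ hd hσ := by
    obtain ⟨p, B, hp⟩ := hf.exists_prog d (fun i => σ (i + 1)) hd fun i => hσ (i + 1)
    exact ⟨p, B, fun s X hX =>
      hp s X ⟨hX.mem_le_one, hX.size_le, fun i => hX.env_le (i + 1)⟩⟩

theorem exists_prog_summand (hg : PolyComputable g) {d : ℕ} {σ : ℕ → ℕ} (hd : 0 < d)
    (hσ : ∀ i, σ i < d) :
    ∃ (q : Prog) (C : Polynomial ℕ), ∀ (s : State) X Y, InputsLE (s.reg 0) s.mem (s.reg ∘ σ) X →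
      ∀ N ≤ Y, ∀ s', s.AgreeBelow d s' → s'.reg (d + 2) < N → Computes q (d + 3) s'
        (g (s.reg 0) s.mem (consEnv (s'.reg (d + 2)) (s.reg ∘ σ))) (C.eval (X + Y)) := by
  obtain ⟨q, C, hq⟩ := hg.exists_prog (d + 3) (consEnv (d + 2) σ) (by omega) fun
    | 0 => Nat.lt_succ_self _
    | i + 1 => (hσ i).trans (by omega)
  refine ⟨q, C, fun s X Y hX N hN s' hagree hlt => ?_⟩
  have henv : s'.reg ∘ consEnv (d + 2) σ = consEnv (s'.reg (d + 2)) (s.reg ∘ σ) := by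
    funext i
    cases i with
    | zero => rfl
    | succ i => exact hagree.reg_eq _ (hσ i)
  have hq' := hq s' (X + Y)
  rw [hagree.mem_eq, hagree.reg_eq 0 hd, henv] at hq'
  exact hq' (hX.consEnv hN hlt)

theorem sum (hf : PolyComputable f) (hg : PolyComputable g) :
    PolyComputable fun n m env => ∑ w ∈ Finset.range (f n m env), g n m (consEnv w env) where
  polyBounded := hf.polyBounded.sum hg.polyBounded
  exists_prog d σ hd hσ := by
    obtain ⟨A, hA⟩ := hf.polyBounded
    obtain ⟨p, B, hp⟩ := hf.exists_prog (d + 1) σ d.succ_pos fun i => (hσ i).trans d.lt_succ_self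
    obtain ⟨q, C, hq⟩ := hg.exists_prog_summand hd hσ
    refine ⟨.seq p (.seq (.const d 0) (.seq (.const (d + 2) 0) (.whilePos (d + 1) (sumBody d q)))),
      B + A * (C.comp (Polynomial.X + A) + 5) + 3, fun s X hX => ?_⟩
    have hN := hA _ _ _ X hX
    obtain ⟨s₁, t₁, hrun₁, ht₁, hagree₁, hval₁⟩ := hp s X hX
    set N := f (s.reg 0) s.mem (s.reg ∘ σ)
    have hagree₂ := ((hagree₁.mono d.le_succ).setReg le_rfl 0).setReg (Nat.le_add_right d 2) 0
    obtain ⟨s₃, t₃, hrun₃, ht₃, hagree₃, hval₃⟩ :=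
      computes_sumLoop (v := fun w => g (s.reg 0) s.mem (consEnv w (s.reg ∘ σ))) (hq s X _ hX _ hN)
        N _ hagree₂ (by simpa [State.setReg_reg] using hval₁) (by simp [State.setReg_reg])
    refine ⟨s₃, _, .seq hrun₁ (.seq (.const _ _ _) (.seq (.const _ _ _) hrun₃)), ?_,
      hagree₂.trans hagree₃, ?_⟩
    · have := Nat.mul_le_mul_right (C.eval (X + A.eval X) + 5) hN
      simp only [Polynomial.eval_add, Polynomial.eval_mul, Polynomial.eval_comp, Polynomial.eval_X,
        Polynomial.eval_ofNat]
      omega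
    · simp [hval₃, State.setReg_reg]

theorem mul (hf : PolyComputable f) (hg : PolyComputable g) :
    PolyComputable fun n m env => f n m env * g n m env := by
  simpa [consEnv] using sum hf hg.shift

theorem pow (hf : PolyComputable f) (k : ℕ) : PolyComputable fun n m env => f n m env ^ k := by
  induction k with
  | zero => simpa using const 1
  | succ k ih => simpa [pow_succ] using ih.mul hf

end PolyComputable

theorem initState_mem_le_one {n : ℕ} (G : PairGraph n) (a : ℕ) : (initState G).mem a ≤ 1 := by
  simp only [initState]
  split_ifs
  · exact Bool.toNat_le _
  · exact Nat.zero_le _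

theorem polyTime_of_polyComputable {V : ℕ → (ℕ → ℕ) → ℕ}
    (hV : PolyComputable fun n m _ => V n m) :
    PolyTime fun n G => decide (V n (initState G).mem = 0) := by
  obtain ⟨p, B, hp⟩ := hV.exists_prog 1 (fun _ => 0) one_pos fun _ => one_pos
  refine ⟨.seq p (.seq (.const 2 1) (.sub 0 2 1)), B + 2, fun n G => ?_⟩
  obtain ⟨s, t, hrun, ht, -, hval⟩ :=
    hp (initState G) n ⟨initState_mem_le_one G, le_rfl, fun _ => le_rfl⟩
  refine ⟨_, _, .seq hrun (.seq (.const s 2 1) (.sub _ 0 2 1)), ?_, ?_⟩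
  · simp only [Polynomial.eval_add, Polynomial.eval_ofNat]
    omega
  · have hsize : (initState G).reg 0 = n := rfl
    rw [hsize] at hval
    by_cases hzero : V n (initState G).mem = 0
    · simp [State.setReg_reg, hval, hzero]
    · simp [State.setReg_reg, hval, hzero, Nat.one_le_iff_ne_zero]

/-! ### The certificate -/

section Certificate

variable {n : ℕ}

/-- The adjacency matrix, with integer entries. -/
def adjMat (G : PairGraph n) : Matrix (Fin n) (Fin n) ℤ :=
  Matrix.of fun u v => if G (u, v) = true then 1 else 0

/-- The symmetrized adjacency matrix: its row sums are the total degrees of the vertices. -/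
def symAdj (G : PairGraph n) : Matrix (Fin n) (Fin n) ℤ := adjMat G + (adjMat G).transpose

/-- The deviation of the symmetrized adjacency matrix from its average entry, scaled by `n ^ 2` to
have integer entries. -/
def discMat (G : PairGraph n) : Matrix (Fin n) (Fin n) ℤ :=
  (n : ℤ) ^ 2 • symAdj G - Matrix.of fun _ _ => 2 * ((edges G).card : ℤ)

/-- The certificate: every total degree is at least `23 / 24` of the average, and the entries of the
power `2 ^ j` of the discrepancy matrix are small enough to bound its spectral radius. -/
def IsCertified (j : ℕ) (G : PairGraph n) : Prop :=
  4 ≤ n ∧ 0 < (edges G).card ∧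
  (∀ u, 23 * ((edges G).card : ℤ) ≤ 12 * n * ∑ v, symAdj G u v) ∧
  ∀ u v, 12 ^ 2 ^ j * n * |(discMat G ^ 2 ^ j) u v| ≤ (n * (edges G).card : ℤ) ^ 2 ^ j

theorem blockSum_adjMat (G : PairGraph n) (S T : Finset (Fin n)) :
    blockSum (adjMat G) S T = (edges G ∩ S ×ˢ T).card := by
  rw [blockSum, ← Finset.sum_product' (f := fun u v => adjMat G u v)]
  simp [adjMat, edges, Finset.filter_inter]

theorem blockSum_symAdj (G : PairGraph n) (S T : Finset (Fin n)) :
    blockSum (symAdj G) S T = (edges G ∩ S ×ˢ T).card + (edges G ∩ T ×ˢ S).card := by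
  rw [symAdj, blockSum_add, blockSum_transpose, blockSum_adjMat, blockSum_adjMat]

theorem symAdj_isSymm (G : PairGraph n) : (symAdj G).IsSymm := by
  rw [Matrix.IsSymm, symAdj, Matrix.transpose_add, Matrix.transpose_transpose, add_comm]

theorem discMat_isSymm (G : PairGraph n) : (discMat G).IsSymm :=
  ((symAdj_isSymm G).smul _).sub rfl

theorem blockSum_discMat (G : PairGraph n) (S T : Finset (Fin n)) :
    blockSum (discMat G) S T =
      (n : ℤ) ^ 2 * blockSum (symAdj G) S T - 2 * (edges G).card * (S.card * T.card) :=
  blockSum_smul_sub_const _ _ _ _ _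

end Certificate

/-! ### The certificate is checked in polynomial time -/

/-- The adjacency bit of `(u, v)` in the memory. -/
def adjAt (n : ℕ) (m : ℕ → ℕ) (u v : ℕ) : ℕ := m (v + n * u)

/-- The symmetrized adjacency matrix of the graph in the memory. -/
def symAt (n : ℕ) (m : ℕ → ℕ) (u v : ℕ) : ℕ := adjAt n m u v + adjAt n m v u

/-- The number of edges of the graph in the memory. -/
def edgeCount (n : ℕ) (m : ℕ → ℕ) : ℕ :=
  ∑ u ∈ Finset.range n, ∑ v ∈ Finset.range n, adjAt n m u v

/-- The entry `(u, v)` of the power `2 ^ j` of the discrepancy matrix is computed without negative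
numbers, as `powAt n m j true u v - powAt n m j false u v`. -/
def powAt (n : ℕ) (m : ℕ → ℕ) : ℕ → Bool → ℕ → ℕ → ℕ
  | 0, true, u, v => n ^ 2 * symAt n m u v
  | 0, false, _, _ => 2 * edgeCount n m
  | j + 1, b, u, v => ∑ w ∈ Finset.range n,
      (powAt n m j true u w * powAt n m j b w v + powAt n m j false u w * powAt n m j (!b) w v)

/-- The total amount by which the inequalities of the certificate are violated: truncated
subtraction makes this vanish exactly when all of them hold. -/
def violation (j n : ℕ) (m : ℕ → ℕ) : ℕ :=
  (4 - n) + (1 - edgeCount n m) +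
  (∑ u ∈ Finset.range n, (23 * edgeCount n m - 12 * n * ∑ v ∈ Finset.range n, symAt n m u v)) +
  ∑ u ∈ Finset.range n, ∑ v ∈ Finset.range n,
    ((12 ^ 2 ^ j * n * powAt n m j true u v -
        (12 ^ 2 ^ j * n * powAt n m j false u v + (n * edgeCount n m) ^ 2 ^ j)) +
      (12 ^ 2 ^ j * n * powAt n m j false u v -
        (12 ^ 2 ^ j * n * powAt n m j true u v + (n * edgeCount n m) ^ 2 ^ j)))

/-- A matrix depending on the input size and the memory, whose entry at any two polynomially
computable indices is polynomially computable. -/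
def MatComputable (F : ℕ → (ℕ → ℕ) → ℕ → ℕ → ℕ) : Prop :=
  ∀ a b : Term, PolyComputable a → PolyComputable b →
    PolyComputable fun n m env => F n m (a n m env) (b n m env)

open PolyComputable

theorem matComputable_adjAt : MatComputable adjAt :=
  fun _ _ ha hb => mem (add hb (mul size ha))

theorem matComputable_symAt : MatComputable symAt := fun a b ha hb =>
  add (matComputable_adjAt a b ha hb) (matComputable_adjAt b a hb ha)

theorem polyComputable_edgeCount : PolyComputable fun n m _ => edgeCount n m :=
  sum size (sum size (matComputable_adjAt _ _ (var 1) (var 0)))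

theorem MatComputable.sum_mul_add_mul {F F' H H' : ℕ → (ℕ → ℕ) → ℕ → ℕ → ℕ}
    (hF : MatComputable F) (hF' : MatComputable F') (hH : MatComputable H)
    (hH' : MatComputable H') :
    MatComputable fun n m u v => ∑ w ∈ Finset.range n,
      (F n m u w * F' n m w v + H n m u w * H' n m w v) := fun _ _ ha hb =>
  sum size (add (mul (hF _ _ ha.shift (var 0)) (hF' _ _ (var 0) hb.shift))
    (mul (hH _ _ ha.shift (var 0)) (hH' _ _ (var 0) hb.shift)))

theorem matComputable_powAt (j : ℕ) : ∀ b, MatComputable fun n m => powAt n m j b := by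
  induction j with
  | zero =>
    rintro (_ | _)
    · exact fun _ _ _ _ => mul (const 2) polyComputable_edgeCount
    · exact fun a b ha hb => mul (pow size 2) (matComputable_symAt a b ha hb)
  | succ j ih => exact fun b => (ih true).sum_mul_add_mul (ih b) (ih false) (ih !b)

theorem polyComputable_violation (j : ℕ) : PolyComputable fun n m _ => violation j n m := by
  have degree_deficit : PolyComputable fun n m env => 23 * edgeCount n m -
      12 * n * ∑ v ∈ Finset.range n, symAt n m (env 0) v :=
    sub (mul (const 23) polyComputable_edgeCount)
      (mul (mul (const 12) size) (sum size (matComputable_symAt _ _ (var 1) (var 0))))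
  have scaled_entry : ∀ b, PolyComputable fun n m env =>
      12 ^ 2 ^ j * n * powAt n m j b (env 1) (env 0) :=
    fun b => mul (mul (const _) size) (matComputable_powAt j b _ _ (var 1) (var 0))
  have entry_bound : PolyComputable fun n m _ => (n * edgeCount n m) ^ 2 ^ j :=
    pow (mul size polyComputable_edgeCount) _
  exact add (add (add (sub (const 4) size) (sub (const 1) polyComputable_edgeCount))
    (sum size degree_deficit))
    (sum size (sum size (add (sub (scaled_entry true) (add (scaled_entry false) entry_bound))
      (sub (scaled_entry false) (add (scaled_entry true) entry_bound)))))

section Correctness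

variable {n : ℕ} (G : PairGraph n)

theorem adjAt_initState (u v : Fin n) :
    (adjAt n (initState G).mem u v : ℤ) = adjMat G u v := by
  have hlt : (v : ℕ) + n * u < n * n := (finProdFinEquiv (u, v)).2
  have hcell : finProdFinEquiv.symm ⟨(v : ℕ) + n * u, hlt⟩ = (u, v) := by
    rw [Equiv.symm_apply_eq]
    rfl
  simp only [adjAt, initState, hlt, dif_pos, hcell, adjMat, Matrix.of_apply]
  cases G (u, v) <;> rfl

theorem symAt_initState (u v : Fin n) : (symAt n (initState G).mem u v : ℤ) = symAdj G u v := by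
  simp [symAt, symAdj, adjAt_initState]

theorem edgeCount_initState : edgeCount n (initState G).mem = (edges G).card := by
  zify
  simp only [edgeCount, Finset.sum_range, Nat.cast_sum, adjAt_initState]
  simpa [blockSum] using blockSum_adjMat G Finset.univ Finset.univ

theorem powAt_initState (j : ℕ) (u v : Fin n) :
    (powAt n (initState G).mem j true u v : ℤ) - powAt n (initState G).mem j false u v =
      (discMat G ^ 2 ^ j) u v := by
  induction j generalizing u v with
  | zero => simp [powAt, discMat, symAt_initState, edgeCount_initState, -zsmul_eq_mul]
  | succ j ih =>
    rw [pow_succ, pow_mul, pow_two, Matrix.mul_apply]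
    simp only [powAt, Finset.sum_range, ← ih, Nat.cast_sum, Nat.cast_add, Nat.cast_mul,
      ← Finset.sum_sub_distrib, Bool.not_true, Bool.not_false]
    exact Finset.sum_congr rfl fun w _ => by ring

theorem violation_eq_zero_iff (j : ℕ) :
    violation j n (initState G).mem = 0 ↔ IsCertified j G := by
  simp only [violation, edgeCount_initState, Finset.sum_range, Nat.add_eq_zero_iff,
    Finset.sum_eq_zero_iff, Finset.mem_univ, true_imp_iff, Nat.sub_eq_zero_iff_le, IsCertified,
    and_assoc, Nat.one_le_iff_ne_zero, pos_iff_ne_zero]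
  refine and_congr Iff.rfl (and_congr Iff.rfl (and_congr (forall_congr' fun u => ?_)
    (forall_congr' fun u => forall_congr' fun v => ?_)))
  · zify
    simp only [symAt_initState]
  · zify
    have hscale : (0 : ℤ) ≤ 12 ^ 2 ^ j * n := by positivity
    rw [← powAt_initState, ← abs_of_nonneg hscale, ← abs_mul, abs_of_nonneg hscale, mul_sub,
      abs_sub_le_iff, sub_le_iff_le_add', sub_le_iff_le_add']

theorem polyTime_isCertified (j : ℕ) [∀ n (G : PairGraph n), Decidable (IsCertified j G)] :
    PolyTime fun _ G => decide (IsCertified j G) := by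
  simpa only [violation_eq_zero_iff] using polyTime_of_polyComputable (polyComputable_violation j)

end Correctness

/-! ### Certified graphs expand -/

section Expansion

open Finset Matrix

variable {n j : ℕ} {G : PairGraph n}

/-- The edges between a vertex set and its complement. -/
def cut (G : PairGraph n) (S : Finset (Fin n)) : Finset (Fin n × Fin n) :=
  edges G ∩ (S ×ˢ Sᶜ ∪ Sᶜ ×ˢ S)

theorem mem_cut {S : Finset (Fin n)} {e : Fin n × Fin n} :
    e ∈ cut G S ↔ e ∈ edges G ∧ ¬(e.1 ∈ S ↔ e.2 ∈ S) := by
  simp only [cut, mem_inter, mem_union, mem_product, mem_compl]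
  tauto

theorem card_cut (G : PairGraph n) (S : Finset (Fin n)) :
    (#(cut G S) : ℤ) = blockSum (symAdj G) S Sᶜ := by
  have hdisj : Disjoint (S ×ˢ Sᶜ) (Sᶜ ×ˢ S) := disjoint_product.2 (.inl disjoint_compl_right)
  rw [blockSum_symAdj, cut, inter_union_distrib_left, card_union_of_disjoint
    (hdisj.mono inter_subset_right inter_subset_right), Nat.cast_add]

theorem IsCertified.blockSum_symAdj_univ_ge (h : IsCertified j G) (S : Finset (Fin n)) :
    23 * (#S * #(edges G) : ℤ) ≤ 12 * n * blockSum (symAdj G) S univ := by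
  obtain ⟨-, -, hdeg, -⟩ := h
  have hsum := card_nsmul_le_sum S _ _ fun u _ => hdeg u
  rw [← mul_sum, nsmul_eq_mul] at hsum
  rw [blockSum]
  linarith

theorem IsCertified.blockSum_symAdj_self_le (h : IsCertified j G) {S : Finset (Fin n)}
    (hS : 2 * #S ≤ n) : 12 * n * blockSum (symAdj G) S S ≤ 13 * (#S * #(edges G) : ℤ) := by
  obtain ⟨hn, -, -, hentry⟩ := h
  have hdisc := mul_abs_blockSum_le_of_pow_apply_le (discMat_isSymm G) (c := 12)
    (A := (n * #(edges G) : ℤ)) (by norm_num) (by positivity)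
    (by simpa only [Fintype.card_fin] using hentry) S
  have hle := le_abs_self (blockSum (discMat G) S S)
  rw [blockSum_discMat] at hdisc hle
  have hprod : (2 * #S : ℤ) * (#S * #(edges G)) ≤ n * (#S * #(edges G)) := by
    gcongr
    exact_mod_cast hS
  refine le_of_mul_le_mul_left ?_ (show (0 : ℤ) < n by omega)
  linarith

theorem IsCertified.le_card_cut (h : IsCertified j G) {S : Finset (Fin n)} (hS : 2 * #S ≤ n) :
    5 * (#S * #(edges G)) ≤ 6 * n * #(cut G S) := by
  have hdeg := h.blockSum_symAdj_univ_ge S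
  have hinner := h.blockSum_symAdj_self_le hS
  rw [← blockSum_add_blockSum_compl _ S S, ← card_cut] at hdeg
  zify
  linarith

end Expansion

/-! ### Approximate solutions on certified graphs -/

section ApproxSat

open Finset

variable {n j : ℕ} {G : PairGraph n} {b : Signing n} {η : ℝ} {x x' : Assignment n}

theorem hammingDist_neg_add {ι : Type*} [Fintype ι] (x x' : ι → ℤˣ) :
    hammingDist x' (-x) + hammingDist x' x = Fintype.card ι := by
  have hneg : ∀ i, x' i ≠ (-x) i ↔ ¬x' i ≠ x i := fun i => by
    simp [Int.units_ne_iff_eq_neg]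
  simp only [hammingDist, hneg]
  rw [add_comm, card_filter_add_card_filter_not, card_univ]

theorem satisfied_neg (G : PairGraph n) (b : Signing n) (x : Assignment n) :
    satisfied G b (-x) = satisfied G b x := by
  simp [satisfied]

theorem IsApproxSat.neg (hx : IsApproxSat G b η x) : IsApproxSat G b η (-x) := by
  rwa [IsApproxSat, satisfied_neg]

theorem IsApproxSat.card_edges_sdiff_satisfied_le (hx : IsApproxSat G b η x) :
    (#(edges G \ satisfied G b x) : ℝ) ≤ η * #(edges G) := by
  have hsub : satisfied G b x ⊆ edges G := filter_subset _ _
  rw [cast_card_sdiff hsub]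
  rw [IsApproxSat] at hx
  linarith

theorem cut_subset_unsatisfied (G : PairGraph n) (b : Signing n) (x x' : Assignment n) :
    cut G {i | x' i ≠ x i} ⊆ (edges G \ satisfied G b x) ∪ (edges G \ satisfied G b x') := by
  rintro ⟨u, v⟩ he
  obtain ⟨hedge, hcut⟩ := mem_cut.1 he
  simp only [mem_filter, mem_univ, true_and] at hcut
  simp only [satisfied, mem_union, mem_sdiff, mem_filter, hedge, true_and]
  by_contra! hsat
  refine hcut ?_
  have hprod : x' u * x' v = x u * x v := hsat.2.trans hsat.1.symm
  constructor
  · contrapose!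
    intro hv
    simpa [hv] using hprod
  · contrapose!
    intro hu
    simpa [hu] using hprod

theorem IsCertified.hammingDist_le (h : IsCertified j G) (hx : IsApproxSat G b η x)
    (hx' : IsApproxSat G b η x') (hhalf : 2 * hammingDist x' x ≤ n) :
    (hammingDist x' x : ℝ) ≤ 12 / 5 * (η * n) := by
  have hexpand : 5 * ((hammingDist x' x : ℝ) * #(edges G)) ≤
      6 * n * #(cut G {i | x' i ≠ x i}) := by
    exact_mod_cast h.le_card_cut hhalf
  have hcut : (#(cut G {i | x' i ≠ x i}) : ℝ) ≤ 2 * η * #(edges G) := by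
    have hcard : (#(cut G {i | x' i ≠ x i}) : ℝ) ≤
        #(edges G \ satisfied G b x) + #(edges G \ satisfied G b x') := by
      exact_mod_cast (card_le_card (cut_subset_unsatisfied G b x x')).trans (card_union_le _ _)
    linarith [hx.card_edges_sdiff_satisfied_le, hx'.card_edges_sdiff_satisfied_le]
  have hedges : (0 : ℝ) < #(edges G) := by exact_mod_cast h.2.1
  refine le_of_mul_le_mul_right ?_ hedges
  have : 6 * (n : ℝ) * #(cut G {i | x' i ≠ x i}) ≤ 6 * n * (2 * η * #(edges G)) := by gcongr
  linarith

theorem IsCertified.hammingDist_le_or (h : IsCertified j G) (hx : IsApproxSat G b η x)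
    (hx' : IsApproxSat G b η x') :
    (hammingDist x' x : ℝ) ≤ 12 / 5 * (η * n) ∨ (hammingDist x' (-x) : ℝ) ≤ 12 / 5 * (η * n) := by
  have hsum := hammingDist_neg_add x x'
  rw [Fintype.card_fin] at hsum
  rcases le_total (2 * hammingDist x' x) n with hhalf | hhalf
  · exact .inl (h.hammingDist_le hx hx' hhalf)
  · exact .inr (h.hammingDist_le hx.neg hx' (by omega))

end ApproxSat

/-! ### Counting -/

section Counting

open Finset

variable {ι : Type*} [Fintype ι]

theorem injective_filter_ne (x : ι → ℤˣ) :
    Function.Injective fun x' : ι → ℤˣ => ({i | x' i ≠ x i} : Finset ι) := by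
  intro y z hyz
  funext i
  have hi := congrArg (i ∈ ·) hyz
  simp only [mem_filter, mem_univ, true_and, eq_iff_iff] at hi
  by_cases hy : y i = x i
  · rw [hy, not_not.1 (mt hi.2 (not_not.2 hy))]
  · rw [Int.units_ne_iff_eq_neg.1 hy, Int.units_ne_iff_eq_neg.1 (hi.1 hy)]

theorem sum_choose_le (N r : ℕ) : ∑ i ∈ range (r + 1), N.choose i ≤ (N + 1) ^ r := by
  rw [add_pow]
  refine sum_le_sum fun i hi => ?_
  rw [one_pow, mul_one]
  exact (Nat.choose_le_pow N i).trans
    (Nat.le_mul_of_pos_right _ (Nat.choose_pos (Nat.lt_succ_iff.1 (mem_range.1 hi))))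

theorem card_hammingBall_le [DecidableEq ι] (x : ι → ℤˣ) (r : ℕ) :
    #{x' : ι → ℤˣ | hammingDist x' x ≤ r} ≤ (Fintype.card ι + 1) ^ r := by
  have hmaps : Set.MapsTo (fun x' : ι → ℤˣ => ({i | x' i ≠ x i} : Finset ι))
      ({x' : ι → ℤˣ | hammingDist x' x ≤ r} : Finset _)
      ((range (r + 1)).biUnion fun i => powersetCard i univ : Finset (Finset ι)) := by
    intro y hy
    simpa [Nat.lt_succ_iff, hammingDist] using hy
  calc #{x' : ι → ℤˣ | hammingDist x' x ≤ r}
      ≤ #((range (r + 1)).biUnion fun i => powersetCard i (univ : Finset ι)) :=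
        card_le_card_of_injOn _ hmaps (injective_filter_ne x).injOn
    _ ≤ ∑ i ∈ range (r + 1), #(powersetCard i (univ : Finset ι)) := card_biUnion_le
    _ = ∑ i ∈ range (r + 1), (Fintype.card ι).choose i := by simp
    _ ≤ (Fintype.card ι + 1) ^ r := sum_choose_le _ r

theorem log_add_one_le {t : ℝ} (ht : 4 ≤ t) : Real.log (t + 1) ≤ 5 / 4 * Real.log t := by
  have hpow : (t + 1) ^ 4 ≤ t ^ 5 :=
    calc (t + 1) ^ 4 ≤ (5 / 4 * t) ^ 4 := by gcongr; linarith
      _ = 625 / 256 * t ^ 4 := by ring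
      _ ≤ t * t ^ 4 := by gcongr; linarith
      _ = t ^ 5 := by ring
  have hlog := Real.log_le_log (by positivity) hpow
  rw [Real.log_pow, Real.log_pow] at hlog
  push_cast at hlog
  linarith

variable {n : ℕ} {η : ℝ}

theorem two_mul_pow_le_countBound (hn : 4 ≤ n) (hη : 0 ≤ η) :
    2 * ((n : ℝ) + 1) ^ ⌊12 / 5 * (η * n)⌋₊ ≤ countBound n η := by
  have hn' : (4 : ℝ) ≤ n := by exact_mod_cast hn
  rw [countBound]
  split_ifs with hsmall
  · have hfloor : ⌊12 / 5 * (η * n)⌋₊ = 0 := by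
      rw [Nat.floor_eq_zero]
      rw [le_div_iff₀ (by positivity)] at hsmall
      linarith
    simp [hfloor]
  · refine mul_le_mul_of_nonneg_left ?_ zero_le_two
    rw [← Real.exp_log (show (0 : ℝ) < n + 1 by positivity), ← Real.exp_nat_mul,
      Real.exp_le_exp]
    have hlog : 0 ≤ Real.log (n + 1) := Real.log_nonneg (by linarith)
    calc (⌊12 / 5 * (η * n)⌋₊ : ℝ) * Real.log (n + 1)
        ≤ 12 / 5 * (η * n) * (5 / 4 * Real.log n) := by
          gcongr
          · exact Nat.floor_le (by positivity)
          · exact log_add_one_le hn'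
      _ = 3 * η * n * Real.log n := by ring

theorem IsCertified.ncard_le {j : ℕ} {G : PairGraph n} (h : IsCertified j G) (b : Signing n)
    (hη : 0 ≤ η) : ({x : Assignment n | IsApproxSat G b η x}.ncard : ℝ) ≤ countBound n η := by
  refine le_trans ?_ (two_mul_pow_le_countBound h.1 hη)
  set r := ⌊12 / 5 * (η * n)⌋₊
  rcases Set.eq_empty_or_nonempty {x : Assignment n | IsApproxSat G b η x} with hempty | ⟨x, hx⟩
  · rw [hempty, Set.ncard_empty, Nat.cast_zero]
    positivity
  have hsub : {x : Assignment n | IsApproxSat G b η x} ⊆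
      (({x' : Assignment n | hammingDist x' x ≤ r} : Finset (Assignment n)) ∪
        ({x' : Assignment n | hammingDist x' (-x) ≤ r} : Finset (Assignment n)) :
          Finset (Assignment n)) := by
    intro x' hx'
    simpa using (h.hammingDist_le_or hx hx').imp Nat.le_floor Nat.le_floor
  have hcard := (Set.ncard_le_ncard hsub (finite_toSet _)).trans_eq (Set.ncard_coe_finset _)
  have hballs := hcard.trans ((card_union_le _ _).trans
    (add_le_add (card_hammingBall_le x r) (card_hammingBall_le (-x) r)))
  rw [← two_mul, Fintype.card_fin] at hballs
  exact_mod_cast hballs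

theorem ncard_assignment_le (s : Set (Assignment n)) : (s.ncard : ℝ) ≤ 2 ^ n := by
  have hcard := Set.ncard_le_card s
  rw [Nat.card_eq_fintype_card, Fintype.card_fun, Fintype.card_fin] at hcard
  exact_mod_cast hcard

end Counting

/-! ### Random graphs are nearly regular and have small discrepancy -/

section RandomGraph

open Finset Real

variable {n : ℕ}

/-- All out-degrees and in-degrees of `G` are within a relative error `ε` of the expected degree
`p * n`. -/
def IsNearlyRegular (p ε : ℝ) (G : PairGraph n) : Prop :=
  ∀ u, |excess p ({u} ×ˢ univ) G| ≤ ε * (p * n) ∧ |excess p (univ ×ˢ {u}) G| ≤ ε * (p * n)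

theorem measure_not_isNearlyRegular_le (p : unitInterval) {ε : ℝ} (hε : 0 ≤ ε) (hε₂ : ε ≤ 2) :
    (bernoulliPi (Fin n × Fin n) p).real {G : PairGraph n | ¬ IsNearlyRegular (p : ℝ) ε G} ≤
      4 * n * exp (-(ε ^ 2 * (p * n) / 4)) := by
  have hsub : {G : PairGraph n | ¬ IsNearlyRegular (p : ℝ) ε G} ⊆ ⋃ u ∈ (univ : Finset (Fin n)),
      ({G | ε * (p * n) < |excess p ({u} ×ˢ univ) G|} ∪
        {G | ε * (p * n) < |excess p (univ ×ˢ {u}) G|}) := fun G hG => by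
    have hG : ¬ IsNearlyRegular (p : ℝ) ε G := hG
    simp only [IsNearlyRegular, not_forall, not_and_or, not_le] at hG
    simpa using hG
  have hd : 0 ≤ (p : ℝ) * n := mul_nonneg p.2.1 n.cast_nonneg
  have htail : ∀ E : Finset (Fin n × Fin n), #E = n →
      (bernoulliPi (Fin n × Fin n) p).real {G | ε * (p * n) < |excess p E G|} ≤
        2 * exp (-(ε ^ 2 * (p * n) / 4)) := fun E hE => by
    refine measure_lt_abs_excess_le p E (by positivity) ?_ (le_of_eq ?_)
    · nlinarith [mul_nonneg hε hd]
    · rw [hE]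
      ring
  calc _ ≤ _ := measureReal_mono hsub (measure_ne_top _ _)
    _ ≤ _ := measureReal_biUnion_finset_le _ _
    _ ≤ ∑ _u : Fin n,
        (2 * exp (-(ε ^ 2 * (p * n) / 4)) + 2 * exp (-(ε ^ 2 * (p * n) / 4))) :=
      sum_le_sum fun u _ => (measureReal_union_le _ _).trans
        (add_le_add (htail _ (by simp)) (htail _ (by simp)))
    _ = 4 * n * exp (-(ε ^ 2 * (p * n) / 4)) := by
      rw [sum_const, card_univ, Fintype.card_fin, nsmul_eq_mul]
      ring

/-- Two sets are comparable if their sizes differ at most by the factor `(2 * d / α) ^ 2`. For other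
pairs, the bound on the degrees of a graph with expected degree `d` already implies that the
discrepancy is `O(α)`. -/
def Comparable {ι κ : Type*} (d α : ℝ) (S : Finset ι) (T : Finset κ) : Prop :=
  α ^ 2 * #T ≤ 4 * d ^ 2 * #S ∧ α ^ 2 * #S ≤ 4 * d ^ 2 * #T

/-- The number of edges between comparable nonempty vertex sets is close to its expectation. -/
def HasComparableDiscrepancyLE (p α : ℝ) (G : PairGraph n) : Prop :=
  ∀ S T : Finset (Fin n), S.Nonempty → T.Nonempty → Comparable (p * n) α S T →
    |excess p (S ×ˢ T) G| ≤ α * √(#S * #T)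

theorem sum_nonempty_exp_neg_mul_card_le {ι : Type*} [Fintype ι] {Q : ℝ}
    (hQ : Fintype.card ι * exp (-Q) ≤ 1) :
    ∑ S : Finset ι with S.Nonempty, exp (-(Q * #S)) ≤ 2 * (Fintype.card ι * exp (-Q)) := by
  classical
  have hbinomial : ∑ S : Finset ι, exp (-(Q * #S)) = (exp (-Q) + 1) ^ Fintype.card ι := by
    rw [← card_univ, ← sum_pow_mul_eq_add_pow, powerset_univ]
    refine sum_congr rfl fun S _ => ?_
    rw [one_pow, mul_one, ← exp_nat_mul]
    ring_nf
  have hempty : ∑ S : Finset ι, exp (-(Q * #S)) =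
      ∑ S : Finset ι with S.Nonempty, exp (-(Q * #S)) + 1 := by
    rw [← sum_filter_add_sum_filter_not univ (·.Nonempty)]
    simp [filter_eq']
  have hexp : (exp (-Q) + 1) ^ Fintype.card ι ≤ exp (Fintype.card ι * exp (-Q)) := by
    rw [exp_nat_mul]
    gcongr
    exact add_one_le_exp _
  have hnonneg : 0 ≤ Fintype.card ι * exp (-Q) := by positivity
  have htaylor := abs_exp_sub_one_le (x := Fintype.card ι * exp (-Q))
    (by rwa [abs_of_nonneg hnonneg])
  rw [abs_of_nonneg hnonneg] at htaylor
  linarith [le_of_abs_le htaylor]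

theorem Comparable.exponent_le {ι κ : Type*} {d α : ℝ} {S : Finset ι} {T : Finset κ}
    (h : Comparable d α S T) (hd : 0 < d) (hα : 0 ≤ α) :
    α ^ 2 / (8 * d) * (#S + #T) ≤ α * √(#S * #T) / 2 := by
  have hsize : ∀ s t : ℝ, 0 ≤ s → 0 ≤ t → α ^ 2 * t ≤ 4 * d ^ 2 * s →
      α * t ≤ 2 * d * √(s * t) := fun s t hs ht hst => by
    refine (sq_le_sq₀ (by positivity) (by positivity)).1 ?_
    rw [mul_pow _ √(s * t), sq_sqrt (by positivity)]
    nlinarith [mul_le_mul_of_nonneg_right hst ht]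
  have hT := hsize #S #T (by positivity) (by positivity) h.1
  have hS := hsize #T #S (by positivity) (by positivity) h.2
  rw [mul_comm (#T : ℝ)] at hS
  rw [div_mul_eq_mul_div, div_le_iff₀ (by positivity)]
  nlinarith [mul_le_mul_of_nonneg_left (add_le_add hS hT) hα]

theorem measure_comparable_lt_abs_excess_le (p : unitInterval) {α : ℝ} (hα : 0 ≤ α)
    {S T : Finset (Fin n)} (hd : 0 < (p : ℝ) * n) (hST : Comparable ((p : ℝ) * n) α S T) :
    (bernoulliPi (Fin n × Fin n) p).real {G | α * √(#S * #T) < |excess p (S ×ˢ T) G|} ≤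
      2 * (exp (-(α ^ 2 / (8 * (p * n)) * #S)) * exp (-(α ^ 2 / (8 * (p * n)) * #T))) := by
  rw [← exp_add, ← neg_add, ← mul_add]
  refine measure_lt_abs_excess_le p (S ×ˢ T) (by positivity) (hST.exponent_le hd hα) ?_
  have hp : (0 : ℝ) ≤ p := p.2.1
  have hcard : (#S : ℝ) + #T ≤ 2 * n := by
    have hS : (#S : ℝ) ≤ n := mod_cast card_finset_fin_le S
    have hT : (#T : ℝ) ≤ n := mod_cast card_finset_fin_le T
    linarith
  rw [mul_pow, sq_sqrt (by positivity), card_product, Nat.cast_mul, ← mul_assoc, mul_div_assoc',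
    div_mul_eq_mul_div, div_le_iff₀ (by positivity)]
  calc 4 * (#S * #T * (p : ℝ)) * α ^ 2 * (#S + #T)
      ≤ 4 * (#S * #T * (p : ℝ)) * α ^ 2 * (2 * n) := by gcongr
    _ = α ^ 2 * (#S * #T) * (8 * (p * n)) := by ring

theorem measure_not_hasComparableDiscrepancyLE_le (p : unitInterval) (hd : 0 < (p : ℝ) * n) {α : ℝ}
    (hα : 0 ≤ α) (hunion : n * exp (-(α ^ 2 / (8 * (p * n)))) ≤ 1) :
    (bernoulliPi (Fin n × Fin n) p).real
      {G : PairGraph n | ¬ HasComparableDiscrepancyLE (p : ℝ) α G} ≤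
      8 * (n * exp (-(α ^ 2 / (8 * (p * n))))) := by
  classical
  set Q := α ^ 2 / (8 * ((p : ℝ) * n)) with hQ
  set F : Finset (Finset (Fin n)) := {S | S.Nonempty} with hF
  have hsub : {G : PairGraph n | ¬ HasComparableDiscrepancyLE (p : ℝ) α G} ⊆
      ⋃ P ∈ (F ×ˢ F).filter fun P => Comparable ((p : ℝ) * n) α P.1 P.2,
        {G | α * √(#P.1 * #P.2) < |excess p (P.1 ×ˢ P.2) G|} := fun G hG => by
    have hG : ¬ HasComparableDiscrepancyLE (p : ℝ) α G := hG
    simp only [HasComparableDiscrepancyLE, not_forall, not_le] at hG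
    obtain ⟨S, T, hS, hT, hST, hlt⟩ := hG
    simp only [Set.mem_iUnion]
    exact ⟨(S, T), by simp [hF, hS, hT, hST], hlt⟩
  have hsum : ∑ S ∈ F, exp (-(Q * #S)) ≤ 2 * (n * exp (-Q)) := by
    simpa using sum_nonempty_exp_neg_mul_card_le (ι := Fin n) (Q := Q) (by simpa using hunion)
  have hsum_nonneg : 0 ≤ ∑ S ∈ F, exp (-(Q * #S)) := sum_nonneg fun S _ => (exp_pos _).le
  calc _ ≤ _ := measureReal_mono hsub (measure_ne_top _ _)
    _ ≤ _ := measureReal_biUnion_finset_le _ _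
    _ ≤ ∑ P ∈ (F ×ˢ F).filter fun P => Comparable ((p : ℝ) * n) α P.1 P.2,
        2 * (exp (-(Q * #P.1)) * exp (-(Q * #P.2))) := sum_le_sum fun P hP =>
      measure_comparable_lt_abs_excess_le p hα hd (mem_filter.1 hP).2
    _ ≤ ∑ P ∈ F ×ˢ F, 2 * (exp (-(Q * #P.1)) * exp (-(Q * #P.2))) :=
      sum_le_sum_of_subset_of_nonneg (filter_subset _ _) fun _ _ _ => by positivity
    _ = 2 * ((∑ S ∈ F, exp (-(Q * #S))) * ∑ S ∈ F, exp (-(Q * #S))) := by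
      rw [← mul_sum, sum_product, sum_mul_sum]
    _ ≤ 2 * ((2 * (n * exp (-Q))) * (2 * (n * exp (-Q)))) := by gcongr
    _ = 8 * (n * exp (-Q)) * (n * exp (-Q)) := by ring
    _ ≤ 8 * (n * exp (-Q)) := mul_le_of_le_one_right (by positivity) hunion

end RandomGraph

/-! ### Nearly regular graphs of small discrepancy are certified -/

section Excess

open Finset

variable {ι : Type*}

theorem excess_eq_card_filter_sub (p : ℝ) (E : Finset ι) (G : ι → Bool) :
    excess p E G = #{e ∈ E | G e = true} - p * #E := by
  simp [excess, mul_comm]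

theorem abs_excess_le_of_subset {p : ℝ} (hp : 0 ≤ p) {E F : Finset ι} (hEF : E ⊆ F)
    (G : ι → Bool) : |excess p E G| ≤ |excess p F G| + p * #F := by
  have hcard : (#E : ℝ) ≤ #F := mod_cast card_le_card hEF
  have htrue : (#{e ∈ E | G e = true} : ℝ) ≤ #{e ∈ F | G e = true} :=
    mod_cast card_le_card (filter_subset_filter _ hEF)
  have hE := mul_le_mul_of_nonneg_left hcard hp
  have hF : (#{e ∈ F | G e = true} : ℝ) - p * #F ≤ |excess p F G| :=
    (excess_eq_card_filter_sub p F G).symm.le.trans (le_abs_self _)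
  have hF_nonneg := abs_nonneg (excess p F G)
  rw [abs_le, excess_eq_card_filter_sub p E]
  constructor <;> linarith [(#{e ∈ E | G e = true}).cast_nonneg (α := ℝ),
    mul_nonneg hp (#E).cast_nonneg]

end Excess

section Completeness

open Finset

variable {n : ℕ} {p ε α : ℝ} {G : PairGraph n}

theorem IsNearlyRegular.abs_excess_product_univ_le (h : IsNearlyRegular p ε G)
    (S : Finset (Fin n)) : |excess p (S ×ˢ univ) G| ≤ ε * (p * n) * #S := by
  have hrows : excess p (S ×ˢ univ) G = ∑ u ∈ S, excess p ({u} ×ˢ univ) G := by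
    simp only [excess, sum_product, sum_singleton]
  rw [hrows, mul_comm, ← nsmul_eq_mul]
  exact (abs_sum_le_sum_abs _ _).trans (sum_le_card_nsmul _ _ _ fun u _ => (h u).1)

theorem IsNearlyRegular.abs_excess_univ_product_le (h : IsNearlyRegular p ε G)
    (T : Finset (Fin n)) : |excess p (univ ×ˢ T) G| ≤ ε * (p * n) * #T := by
  have hcols : excess p (univ ×ˢ T) G = ∑ v ∈ T, excess p (univ ×ˢ {v}) G := by
    simp only [excess, sum_product_right, sum_singleton]
  rw [hcols, mul_comm, ← nsmul_eq_mul]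
  exact (abs_sum_le_sum_abs _ _).trans (sum_le_card_nsmul _ _ _ fun v _ => (h v).2)

theorem IsNearlyRegular.abs_excess_product_le (h : IsNearlyRegular p ε G) (hp : 0 ≤ p) (hε : ε ≤ 1)
    (S T : Finset (Fin n)) :
    |excess p (S ×ˢ T) G| ≤ 2 * (p * n) * #S ∧ |excess p (S ×ˢ T) G| ≤ 2 * (p * n) * #T := by
  have hscale : ∀ s : ℕ, ε * (p * n) * s + p * (n * s) ≤ 2 * (p * n) * s := fun s => by
    have hnonneg : 0 ≤ p * n * s := by positivity
    nlinarith
  constructor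
  · refine (abs_excess_le_of_subset hp (product_subset_product_right (subset_univ T)) G).trans ?_
    refine le_trans ?_ (hscale #S)
    simpa [mul_comm (n : ℝ)] using h.abs_excess_product_univ_le S
  · refine (abs_excess_le_of_subset hp (product_subset_product_left (subset_univ S)) G).trans ?_
    refine le_trans ?_ (hscale #T)
    simpa using h.abs_excess_univ_product_le T

theorem IsNearlyRegular.abs_excess_product_le_mul_sqrt (h : IsNearlyRegular p ε G) (hp : 0 ≤ p)
    (hε : ε ≤ 1) (hα : 0 ≤ α) (hG : HasComparableDiscrepancyLE p α G) (S T : Finset (Fin n)) :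
    |excess p (S ×ˢ T) G| ≤ α * √(#S * #T) := by
  rcases S.eq_empty_or_nonempty with rfl | hS
  · simp [excess]
  rcases T.eq_empty_or_nonempty with rfl | hT
  · simp [excess]
  by_cases hST : Comparable (p * n) α S T
  · exact hG S T hS hT hST
  obtain ⟨hleft, hright⟩ := h.abs_excess_product_le hp hε S T
  have hunbalanced : ∀ s t : ℝ, 0 ≤ s → 0 ≤ t → 4 * (p * n) ^ 2 * s ≤ α ^ 2 * t →
      2 * (p * n) * s ≤ α * √(s * t) := fun s t hs ht hst => by
    refine (sq_le_sq₀ (by positivity) (by positivity)).1 ?_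
    rw [mul_pow α, Real.sq_sqrt (by positivity)]
    nlinarith [mul_le_mul_of_nonneg_right hst hs]
  rw [Comparable, not_and_or, not_le, not_le] at hST
  rcases hST with hlt | hlt
  · exact hleft.trans (hunbalanced _ _ (Nat.cast_nonneg _) (Nat.cast_nonneg _) hlt.le)
  · rw [mul_comm (#S : ℝ)]
    exact hright.trans (hunbalanced _ _ (Nat.cast_nonneg _) (Nat.cast_nonneg _) hlt.le)

theorem card_edges_inter_eq_excess_add (p : ℝ) (G : PairGraph n) (E : Finset (Fin n × Fin n)) :
    (#(edges G ∩ E) : ℝ) = excess p E G + p * #E := by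
  rw [excess_eq_card_filter_sub, sub_add_cancel, edges, filter_inter, univ_inter]

theorem card_edges_eq_excess_add (p : ℝ) (G : PairGraph n) :
    (#(edges G) : ℝ) = excess p (univ ×ˢ univ) G + p * n * n := by
  simpa [mul_assoc] using card_edges_inter_eq_excess_add p G univ

theorem blockSum_discMat_eq_excess (p : ℝ) (G : PairGraph n) (S T : Finset (Fin n)) :
    blockSum ((discMat G).map ((↑) : ℤ → ℝ)) S T =
      n ^ 2 * (excess p (S ×ˢ T) G + excess p (T ×ˢ S) G) -
        2 * excess p (univ ×ˢ univ) G * (#S * #T) := by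
  have hcast : blockSum ((discMat G).map ((↑) : ℤ → ℝ)) S T = (blockSum (discMat G) S T : ℤ) := by
    simp [blockSum]
  rw [hcast, blockSum_discMat, blockSum_symAdj]
  push_cast
  rw [card_edges_eq_excess_add p, card_edges_inter_eq_excess_add p,
    card_edges_inter_eq_excess_add p, card_product, card_product]
  push_cast
  ring

theorem hasDiscrepancyLE_discMat (hα : 0 ≤ α)
    (h : ∀ S T : Finset (Fin n), |excess p (S ×ˢ T) G| ≤ α * √(#S * #T)) :
    HasDiscrepancyLE ((discMat G).map ((↑) : ℤ → ℝ)) (4 * n ^ 2 * α) := by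
  intro S T
  have hsqrt : √((#S : ℝ) * #T) ≤ n := by
    refine Real.sqrt_le_iff.2 ⟨n.cast_nonneg, ?_⟩
    rw [sq]
    gcongr
    exacts [card_finset_fin_le S, card_finset_fin_le T]
  have hcard : (#S : ℝ) * #T ≤ n * √(#S * #T) := by
    nth_rw 1 [← Real.mul_self_sqrt (show (0 : ℝ) ≤ #S * #T by positivity)]
    gcongr
  have hTS := h T S
  have huniv := h univ univ
  rw [mul_comm (#T : ℝ)] at hTS
  rw [card_univ, Fintype.card_fin, Real.sqrt_mul_self n.cast_nonneg] at huniv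
  rw [blockSum_discMat_eq_excess p]
  calc _ ≤ n ^ 2 * (|excess p (S ×ˢ T) G| + |excess p (T ×ˢ S) G|) +
          2 * |excess p (univ ×ˢ univ) G| * (#S * #T) := by
        refine (abs_sub _ _).trans (add_le_add ?_ (by simp [abs_mul]))
        rw [abs_mul, abs_of_nonneg (by positivity)]
        gcongr
        exact abs_add_le _ _
    _ ≤ n ^ 2 * (α * √(#S * #T) + α * √(#S * #T)) + 2 * (α * n) * (n * √(#S * #T)) := by
        gcongr
        exact h S T
    _ = 4 * n ^ 2 * α * √(#S * #T) := by ring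

theorem abs_discMat_apply_le (G : PairGraph n) (u v : Fin n) : |discMat G u v| ≤ 2 * n ^ 2 := by
  have hedges : (#(edges G) : ℤ) ≤ n ^ 2 := by
    have := card_le_univ (edges G)
    rw [Fintype.card_prod, Fintype.card_fin, ← sq] at this
    exact_mod_cast this
  have hadj : ∀ u v, 0 ≤ adjMat G u v ∧ adjMat G u v ≤ 1 := fun u v => by
    simp only [adjMat, Matrix.of_apply]
    split_ifs <;> simp
  have hsym : 0 ≤ symAdj G u v ∧ symAdj G u v ≤ 2 := by
    simp only [symAdj, Matrix.add_apply, Matrix.transpose_apply]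
    constructor <;> linarith [(hadj u v).1, (hadj u v).2, (hadj v u).1, (hadj v u).2]
  have hlower : (0 : ℤ) ≤ n ^ 2 * symAdj G u v := mul_nonneg (by positivity) hsym.1
  have hupper : (n : ℤ) ^ 2 * symAdj G u v ≤ n ^ 2 * 2 :=
    mul_le_mul_of_nonneg_left hsym.2 (by positivity)
  change |(n : ℤ) ^ 2 * symAdj G u v - 2 * #(edges G)| ≤ _
  rw [abs_le]
  constructor <;> linarith

theorem IsNearlyRegular.abs_card_edges_sub_le (h : IsNearlyRegular p ε G) :
    |(#(edges G) : ℝ) - p * n * n| ≤ ε * (p * n * n) := by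
  have hexcess := h.abs_excess_product_univ_le univ
  rw [card_edges_eq_excess_add p, add_sub_cancel_right]
  simpa [mul_assoc] using hexcess

theorem IsNearlyRegular.le_sum_symAdj (h : IsNearlyRegular p ε G) (u : Fin n) :
    2 * (1 - ε) * (p * n) ≤ ∑ v, (symAdj G u v : ℝ) := by
  have hdegree : ∑ v, (symAdj G u v : ℝ) =
      excess p ({u} ×ˢ univ) G + excess p (univ ×ˢ {u}) G + 2 * (p * n) := by
    have hblock : ∑ v, (symAdj G u v : ℝ) = (blockSum (symAdj G) {u} univ : ℤ) := by
      simp [blockSum]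
    rw [hblock, blockSum_symAdj]
    push_cast
    rw [card_edges_inter_eq_excess_add p, card_edges_inter_eq_excess_add p]
    simp
    ring
  linarith [(abs_le.1 (h u).1).1, (abs_le.1 (h u).2).1]

theorem IsNearlyRegular.card_edges_le_sum_symAdj (h : IsNearlyRegular p (1 / 50) G)
    (u : Fin n) : 23 * (#(edges G) : ℤ) ≤ 12 * n * ∑ v, symAdj G u v := by
  have hreal : 23 * (#(edges G) : ℝ) ≤ 12 * n * ∑ v, (symAdj G u v : ℝ) :=
    calc 23 * (#(edges G) : ℝ) ≤ 12 * n * (2 * (1 - 1 / 50) * (p * n)) := by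
          have hedges := h.abs_card_edges_sub_le
          linarith [(abs_le.1 hedges).2, (abs_nonneg _).trans hedges]
      _ ≤ 12 * n * ∑ v, (symAdj G u v : ℝ) := by
          gcongr
          exact h.le_sum_symAdj u
  exact_mod_cast hreal

theorem isCertified_of_discrepancy {j L : ℕ} (hn : 4 ≤ n) (hp : 0 < p)
    (hreg : IsNearlyRegular p (1 / 50) G) (hα : 0 ≤ α) (hG : HasComparableDiscrepancyLE p α G)
    (hL : (2 * n ^ 3) ^ 2 ^ j < 2 ^ L)
    (hα_small : n * (384 * (α * L)) ^ 2 ^ j ≤ (p * n) ^ 2 ^ j) : IsCertified j G := by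
  have hedges : p * n * n / 2 ≤ #(edges G) := by
    linarith [(abs_le.1 hreg.abs_card_edges_sub_le).1, show 0 ≤ p * n * n by positivity]
  refine ⟨hn, ?_, hreg.card_edges_le_sum_symAdj, fun u v => ?_⟩
  · have hn_pos : (0 : ℝ) < n := mod_cast (by omega : 0 < n)
    exact_mod_cast (half_pos (mul_pos (mul_pos hp hn_pos) hn_pos)).trans_le hedges
  have hdisc := hasDiscrepancyLE_discMat hα
    (hreg.abs_excess_product_le_mul_sqrt hp.le (by norm_num) hα hG)
  have hdigits : ((Fintype.card (Fin n) : ℤ) * (2 * n ^ 2)) ^ 2 ^ j < 2 ^ L := by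
    rw [Fintype.card_fin, show (n : ℤ) * (2 * n ^ 2) = 2 * n ^ 3 by ring]
    exact_mod_cast hL
  have hentry := hdisc.abs_pow_apply_le (by positivity) (by nlinarith) (abs_discMat_apply_le G)
    hdigits u v
  have hreal : (12 : ℝ) ^ 2 ^ j * n * |((discMat G ^ 2 ^ j) u v : ℝ)| ≤
      (n * #(edges G)) ^ 2 ^ j :=
    calc (12 : ℝ) ^ 2 ^ j * n * |((discMat G ^ 2 ^ j) u v : ℝ)|
        ≤ 12 ^ 2 ^ j * n * (4 * (4 * n ^ 2 * α) * L) ^ 2 ^ j := by gcongr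
      _ = (n ^ 2 / 2) ^ 2 ^ j * (n * (384 * (α * L)) ^ 2 ^ j) := by
        rw [mul_right_comm, ← mul_pow, show 12 * (4 * (4 * (n : ℝ) ^ 2 * α) * L) =
          n ^ 2 / 2 * (384 * (α * L)) by ring, mul_pow, mul_right_comm, mul_assoc]
      _ ≤ (n ^ 2 / 2) ^ 2 ^ j * (p * n) ^ 2 ^ j := by gcongr
      _ = (n * (p * n * n / 2)) ^ 2 ^ j := by rw [← mul_pow]; ring_nf
      _ ≤ (n * #(edges G)) ^ 2 ^ j := by gcongr
  exact_mod_cast hreal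

end Completeness

/-! ### The random graph is certified with high probability -/

section Asymptotics

open Filter Real

theorem natLog_two_le_two_mul_log (n : ℕ) : (Nat.log 2 n : ℝ) ≤ 2 * log n := by
  have hlogb := natLog_le_logb n 2
  rw [logb, Nat.cast_ofNat, le_div_iff₀ (log_pos one_lt_two)] at hlogb
  nlinarith [log_two_gt_d9, (Nat.log 2 n).cast_nonneg (α := ℝ)]

theorem eventually_mul_natLog_pow_le (K : ℕ) : ∀ᶠ n : ℕ in atTop,
    (384 * ((K * (3 * Nat.log 2 n + 4) : ℕ) : ℝ)) ^ K ≤ n := by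
  set c : ℝ := ((384 * (K * 10)) ^ K + 1)⁻¹ with hc
  have hc_pos : 0 < c := by positivity
  have hlog_pow : ∀ᶠ n : ℕ in atTop, ‖log n ^ K‖ ≤ c * ‖(n : ℝ)‖ :=
    tendsto_natCast_atTop_atTop.eventually ((isLittleO_pow_log_id_atTop (n := K)).bound hc_pos)
  filter_upwards [hlog_pow, eventually_ge_atTop 3] with n hlog_pow hn
  have hn' : (3 : ℝ) ≤ n := mod_cast hn
  have hlog : 1 ≤ log n := by
    rw [le_log_iff_exp_le (by linarith)]
    linarith [exp_one_lt_d9]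
  have hnatLog := natLog_two_le_two_mul_log n
  rw [norm_of_nonneg (by positivity), norm_of_nonneg (by positivity)] at hlog_pow
  calc (384 * ((K * (3 * Nat.log 2 n + 4) : ℕ) : ℝ)) ^ K
      ≤ (384 * (K * (10 * log n))) ^ K := by
        push_cast
        gcongr
        linarith
    _ = (384 * (K * 10)) ^ K * log n ^ K := by rw [← mul_pow]; ring
    _ ≤ c⁻¹ * log n ^ K := by
        gcongr
        rw [hc, inv_inv]
        linarith
    _ ≤ c⁻¹ * (c * n) := by gcongr
    _ = n := inv_mul_cancel_left₀ hc_pos.ne' _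

theorem eventually_mul_exp_neg_rpow_le {δ : ℝ} (hδ : 0 < δ) : ∀ᶠ n : ℕ in atTop,
    12 * (n * exp (-((n : ℝ) ^ (δ / 2) / 10000))) ≤ exp (-(n : ℝ) ^ (δ / 4)) := by
  have hlog : ∀ᶠ n : ℕ in atTop, ‖log n‖ ≤ 1 / 40000 * ‖(n : ℝ) ^ (δ / 2)‖ :=
    tendsto_natCast_atTop_atTop.eventually
      ((isLittleO_log_rpow_atTop (half_pos hδ)).bound (by norm_num))
  have hlarge : ∀ᶠ n : ℕ in atTop, 40000 ≤ (n : ℝ) ^ (δ / 4) :=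
    ((tendsto_rpow_atTop (by positivity : 0 < δ / 4)).comp
      tendsto_natCast_atTop_atTop).eventually_ge_atTop 40000
  filter_upwards [hlog, hlarge, eventually_gt_atTop 0] with n hlog hlarge hn
  have hn_pos : (0 : ℝ) < n := mod_cast hn
  rw [norm_of_nonneg (show (0 : ℝ) ≤ (n : ℝ) ^ (δ / 2) by positivity)] at hlog
  have hlog_le := (le_abs_self _).trans hlog
  have hsq : (n : ℝ) ^ (δ / 2) = (n : ℝ) ^ (δ / 4) * (n : ℝ) ^ (δ / 4) := by
    rw [← rpow_add hn_pos]
    ring_nf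
  have htwelve : (12 : ℝ) ≤ exp 11 := by linarith [add_one_le_exp (11 : ℝ)]
  calc 12 * (n * exp (-((n : ℝ) ^ (δ / 2) / 10000)))
      ≤ exp 11 * (exp (log n) * exp (-((n : ℝ) ^ (δ / 2) / 10000))) := by
        rw [exp_log hn_pos]
        gcongr
    _ = exp (11 + (log n + -((n : ℝ) ^ (δ / 2) / 10000))) := by rw [exp_add, exp_add]
    _ ≤ exp (-(n : ℝ) ^ (δ / 4)) := by
        rw [exp_le_exp]
        nlinarith

theorem two_mul_cube_pow_lt_two_pow (n : ℕ) {K : ℕ} (hK : K ≠ 0) :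
    (2 * n ^ 3) ^ K < 2 ^ (K * (3 * Nat.log 2 n + 4)) := by
  rw [mul_comm K, pow_mul]
  refine Nat.pow_lt_pow_left ?_ hK
  have hn : n < 2 ^ (Nat.log 2 n + 1) := Nat.lt_pow_succ_log_self one_lt_two n
  calc 2 * n ^ 3 < 2 * (2 ^ (Nat.log 2 n + 1)) ^ 3 := by gcongr
    _ = 2 ^ (3 * Nat.log 2 n + 4) := by ring

theorem mul_pow_le_rpow_pow {n K : ℕ} {δ l : ℝ} (hn : 1 ≤ n) (hK : 8 ≤ δ * K)
    (hl_pow : (384 * l) ^ K ≤ n) :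
    n * (384 * ((n : ℝ) ^ (3 / 4 * δ) * l)) ^ K ≤ ((n : ℝ) ^ δ) ^ K := by
  have hn' : (1 : ℝ) ≤ n := mod_cast hn
  have hn_pos := zero_lt_one.trans_le hn'
  have hgain : (n : ℝ) * n ≤ ((n : ℝ) ^ (δ / 4)) ^ K := by
    rw [← rpow_mul_natCast hn_pos.le, ← sq, ← rpow_natCast]
    refine rpow_le_rpow_of_exponent_le hn' ?_
    push_cast
    linarith
  calc n * (384 * ((n : ℝ) ^ (3 / 4 * δ) * l)) ^ K
      = n * (384 * l) ^ K * ((n : ℝ) ^ (3 / 4 * δ)) ^ K := by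
        rw [mul_assoc, ← mul_pow]
        ring
    _ ≤ n * n * ((n : ℝ) ^ (3 / 4 * δ)) ^ K := by gcongr
    _ ≤ ((n : ℝ) ^ (δ / 4)) ^ K * ((n : ℝ) ^ (3 / 4 * δ)) ^ K := by gcongr
    _ = ((n : ℝ) ^ δ) ^ K := by
        rw [← mul_pow, ← rpow_add hn_pos]
        ring_nf

theorem one_sub_le_measure_isCertified {n j L : ℕ} (p : unitInterval) {α : ℝ} (hn : 4 ≤ n)
    (hp : 0 < (p : ℝ)) (hα : 0 ≤ α) (hunion : n * exp (-(α ^ 2 / (8 * (p * n)))) ≤ 1)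
    (hL : (2 * n ^ 3) ^ 2 ^ j < 2 ^ L)
    (hα_small : n * (384 * (α * L)) ^ 2 ^ j ≤ ((p : ℝ) * n) ^ 2 ^ j) :
    1 - (4 * (n * exp (-(p * n / 10000))) + 8 * (n * exp (-(α ^ 2 / (8 * (p * n)))))) ≤
      (bernoulliPi (Fin n × Fin n) p).real {G : PairGraph n | IsCertified j G} := by
  have hd : 0 < (p : ℝ) * n := mul_pos hp (mod_cast (by omega : 0 < n))
  have hregular := measure_not_isNearlyRegular_le (n := n) p (ε := 1 / 50) (by norm_num)
    (by norm_num)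
  have hdiscrepancy := measure_not_hasComparableDiscrepancyLE_le p hd hα hunion
  have hcover : (Set.univ : Set (PairGraph n)) ⊆ {G | IsCertified j G} ∪
      ({G | ¬ IsNearlyRegular (p : ℝ) (1 / 50) G} ∪
        {G | ¬ HasComparableDiscrepancyLE (p : ℝ) α G}) := fun G _ => by
    by_cases hreg : IsNearlyRegular (p : ℝ) (1 / 50) G
    · by_cases hdisc : HasComparableDiscrepancyLE (p : ℝ) α G
      · exact .inl (isCertified_of_discrepancy hn hp hreg hα hdisc hL hα_small)
      · exact .inr (.inr hdisc)
    · exact .inr (.inl hreg)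
  have htotal := (measureReal_mono (μ := bernoulliPi (Fin n × Fin n) p) hcover).trans
    ((measureReal_union_le _ _).trans (add_le_add le_rfl (measureReal_union_le _ _)))
  rw [probReal_univ] at htotal
  rw [show (1 / 50 : ℝ) ^ 2 * (p * n) / 4 = p * n / 10000 by ring] at hregular
  linarith

theorem one_sub_exp_neg_rpow_le_measure_isCertified {n j : ℕ} (p : unitInterval) (hn : 4 ≤ n)
    {δ : ℝ} (hδ : 0 < δ) (hpn : (p : ℝ) * n = (n : ℝ) ^ δ) (hj : 8 ≤ δ * (2 ^ j : ℕ))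
    (hlog : (384 * ((2 ^ j * (3 * Nat.log 2 n + 4) : ℕ) : ℝ)) ^ 2 ^ j ≤ n)
    (hexp : 12 * (n * exp (-((n : ℝ) ^ (δ / 2) / 10000))) ≤ exp (-(n : ℝ) ^ (δ / 4))) :
    1 - exp (-(n : ℝ) ^ (δ / 4)) ≤
      (bernoulliPi (Fin n × Fin n) p).real {G : PairGraph n | IsCertified j G} := by
  have hn_pos : (0 : ℝ) < n := mod_cast (by omega : 0 < n)
  have hn_one : (1 : ℝ) ≤ n := mod_cast (by omega : 1 ≤ n)
  have hd : 0 < (p : ℝ) * n := by rw [hpn]; positivity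
  have hregular : n * exp (-((p : ℝ) * n / 10000)) ≤
      n * exp (-((n : ℝ) ^ (δ / 2) / 10000)) := by
    rw [hpn]
    gcongr
    linarith
  have hdeviation : ((n : ℝ) ^ (3 / 4 * δ)) ^ 2 / (8 * (p * n)) = (n : ℝ) ^ (δ / 2) / 8 := by
    rw [hpn, div_eq_div_iff (by positivity) (by norm_num), mul_left_comm, mul_comm, sq,
      ← rpow_add hn_pos, ← rpow_add hn_pos]
    ring_nf
  have hdiscrepancy : n * exp (-(((n : ℝ) ^ (3 / 4 * δ)) ^ 2 / (8 * (p * n)))) ≤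
      n * exp (-((n : ℝ) ^ (δ / 2) / 10000)) := by
    rw [hdeviation]
    gcongr
    norm_num
  have hexp_le_one : exp (-(n : ℝ) ^ (δ / 4)) ≤ 1 :=
    exp_le_one_iff.2 (neg_nonpos.2 (by positivity))
  have hcertified := one_sub_le_measure_isCertified p hn (pos_of_mul_pos_left hd hn_pos.le)
    (by positivity)
    (hdiscrepancy.trans (by linarith [mul_pos hn_pos (exp_pos (-((n : ℝ) ^ (δ / 2) / 10000)))]))
    (two_mul_cube_pow_lt_two_pow n (pow_ne_zero j two_ne_zero))
    (hpn ▸ mul_pow_le_rpow_pow (by omega) hj hlog)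
  linarith

theorem exists_randomGraph_eq_bernoulliPi {n : ℕ} {m : ℝ} (hm : 0 ≤ m) (hmn : m ≤ (n : ℝ) ^ 2) :
    ∃ p : unitInterval, (p : ℝ) = m / (n : ℝ) ^ 2 ∧
      randomGraph n m = bernoulliPi (Fin n × Fin n) p := by
  have hmem : m / (n : ℝ) ^ 2 ∈ Set.Icc (0 : ℝ) 1 :=
    ⟨by positivity, div_le_one_of_le₀ hmn (by positivity)⟩
  exact ⟨⟨_, hmem⟩, rfl, by rw [randomGraph, Set.projIcc_of_mem _ hmem]⟩

theorem eventually_randomGraph_isCertified {δ : ℝ} (hδ : 0 < δ) (hδ_one : δ ≤ 1) {j : ℕ}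
    (hj : 8 ≤ δ * (2 ^ j : ℕ)) : ∀ᶠ n : ℕ in atTop, 1 - exp (-(n : ℝ) ^ (δ / 4)) ≤
      (randomGraph n ((n : ℝ) ^ (1 + δ))).real {G | IsCertified j G} := by
  filter_upwards [eventually_mul_natLog_pow_le (2 ^ j), eventually_mul_exp_neg_rpow_le hδ,
    eventually_ge_atTop 4] with n hlog hexp hn
  have hn_pos : (0 : ℝ) < n := mod_cast (by omega : 0 < n)
  have hm_le : (n : ℝ) ^ (1 + δ) ≤ (n : ℝ) ^ 2 := by
    rw [← rpow_natCast]
    refine rpow_le_rpow_of_exponent_le (mod_cast (by omega : 1 ≤ n)) ?_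
    push_cast
    linarith
  obtain ⟨p, hp, heq⟩ := exists_randomGraph_eq_bernoulliPi (by positivity) hm_le
  rw [heq]
  refine one_sub_exp_neg_rpow_le_measure_isCertified p hn hδ ?_ hj hlog hexp
  rw [hp, rpow_add hn_pos, rpow_one]
  field_simp

end Asymptotics

end TwoXor

theorem mainTheorem3 :
    ∃ c : ℝ, 0 < c ∧ ∀ δ : ℝ, 0 < δ → δ ≤ 1 →
      ∃ accept : (n : ℕ) → TwoXor.PairGraph n → Bool,
        -- the algorithm runs in polynomial time
        TwoXor.PolyTime accept ∧
        -- on every graph the output bounds the count for every instance on that graph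
        (∀ (n : ℕ) (G : TwoXor.PairGraph n) (η : ℝ), 0 ≤ η → η ≤ 1 →
          ∀ b : TwoXor.Signing n,
            (({x : TwoXor.Assignment n | TwoXor.IsApproxSat G b η x}.ncard : ℕ) : ℝ)
              ≤ TwoXor.certifiedValue (accept n G) n η) ∧
        -- on acceptance, approximate solutions are pairwise close up to a global sign
        (∀ (n : ℕ) (G : TwoXor.PairGraph n), accept n G = true →
          ∀ η : ℝ, 0 ≤ η → η ≤ 1 → ∀ (b : TwoXor.Signing n) (x x' : TwoXor.Assignment n),
            TwoXor.IsApproxSat G b η x → TwoXor.IsApproxSat G b η x' →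
              (hammingDist x' x : ℝ) ≤ 3 * η * n ∨ (hammingDist x' (-x) : ℝ) ≤ 3 * η * n) ∧
        -- the random graph is accepted with high probability
        (∃ n₀ : ℕ, ∀ n : ℕ, n₀ ≤ n →
          1 - Real.exp (-(n : ℝ) ^ (c * δ)) ≤
            (TwoXor.randomGraph n ((n : ℝ) ^ (1 + δ))).real {G | accept n G = true}) := by
  classical
  refine ⟨1 / 4, by norm_num, fun δ hδ hδ_one => ?_⟩
  obtain ⟨j, hj⟩ := pow_unbounded_of_one_lt (8 / δ) (one_lt_two : (1 : ℝ) < 2)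
  have hδj : 8 ≤ δ * (2 ^ j : ℕ) := by
    push_cast
    rw [div_lt_iff₀ hδ] at hj
    linarith
  refine ⟨fun n G => decide (TwoXor.IsCertified j G), TwoXor.polyTime_isCertified j,
    fun n G η hη _ b => ?_, fun n G hG η hη _ b x x' hx hx' => ?_, ?_⟩
  · by_cases hG : TwoXor.IsCertified j G
    · simpa [TwoXor.certifiedValue, hG] using hG.ncard_le b hη
    · simpa [TwoXor.certifiedValue, hG] using
        TwoXor.ncard_assignment_le {x | TwoXor.IsApproxSat G b η x}
  · have hradius : 12 / 5 * (η * n) ≤ 3 * η * n := by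
      linarith [mul_nonneg hη (n.cast_nonneg (α := ℝ))]
    exact ((of_decide_eq_true hG).hammingDist_le_or hx hx').imp hradius.trans' hradius.trans'
  · obtain ⟨n₀, hn₀⟩ :=
      Filter.eventually_atTop.1 (TwoXor.eventually_randomGraph_isCertified hδ hδ_one hδj)
    exact ⟨n₀, fun n hn => by simpa [div_eq_inv_mul] using hn₀ n hn⟩
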